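/- Let $\psi=\Gamma'/\Gamma$, and let $1/\Gamma$ denote the entire reciprocal Gamma function (so $1/\Gamma(z)=0$ for $z=0,-1,-2,\dots$). Let $c,m,f\in\mathbb C$ with $c\notin\mathbb Z$, $f\notin\mathbb Z$, $\Re(m-c)>1$, and suppose that $m\in\mathbb Z$ or $\Re(m-f)>-1$. For integers $l\ge 0$ put $$t_l=\frac{\Gamma(f-c+l)\,(-1)^l}{\Gamma(2-c+l)\,\Gamma(l+1)\,\Gamma(m-1-l)\,(1-c+l)} .$$ (a) If $c-f\notin\{0,1,2,\dots\}$, then $\sum_{l\ge0}t_l$ converges absolutely, and so does the series on the left below, and $$\sum_{l=0}^{\infty}\frac{\Gamma(c+l)}{\Gamma(m+l)}\,\psi(f+l)=\frac{\Gamma(c)}{m-c-1}\left\{\frac{\psi(f-1)+\frac1{m-c-1}}{\Gamma(m-1)}-\frac{\Gamma(f)\Gamma(1-f)\Gamma(1-c)}{\Gamma(f-c)\Gamma(m-f)}-\frac{\Gamma(2-f)\Gamma(m-c)}{\Gamma(m-f)\Gamma(f-c)}\sum_{l=0}^{\infty}t_l\right\}.$$ If moreover $m$ is an integer, then $t_l=0$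 for every $l\ge m-1$, so the series $\sum_l t_l$ terminates. (b) If $c=f+k$ for an integer $k\ge0$, the left-hand series still converges absolutely and the same formula holds with $1/\Gamma(f-c)=0$ in the second term and $\Gamma(f-c+l)/\Gamma(f-c)$ in the third term read as the rising factorial $(f-c)_l$, that is, $$\sum_{l=0}^{\infty}\frac{\Gamma(c+l)}{\Gamma(m+l)}\,\psi(f+l)=\frac{\Gamma(c)}{m-c-1}\left\{\frac{\psi(f-1)+\frac1{m-c-1}}{\Gamma(m-1)}-\frac{\Gamma(2-f)\Gamma(m-c)}{\Gamma(m-f)}\sum_{l=0}^{k}\frac{(f-c)_l\,(-1)^l}{\Gamma(2-c+l)\,\Gamma(l+1)\,\Gamma(m-1-l)\,(1-c+l)}\right\}.$$ -/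

import Mathlib

/-- The general term
`Γ(f-c+l) (-1)^l / (Γ(2-c+l) Γ(l+1) Γ(m-1-l) (1-c+l))` of the auxiliary series.
Mathlib has `Γ = 0` at the poles of `Γ` and `x / 0 = 0`, so that a factor `1 / Γ(m-1-l)` is the
value of the entire function `1 / Γ` for every `m`, including integers. -/
noncomputable def auxTerm (c m f : ℂ) (l : ℕ) : ℂ :=
  Complex.Gamma (f - c + l) * (-1) ^ l /
    (Complex.Gamma (2 - c + l) * Complex.Gamma (l + 1) * Complex.Gamma (m - 1 - l) * (1 - c + l))

/-- The general term of the auxiliary series divided by `Γ(f-c)`, where `Γ(f-c+l) / Γ(f-c)` is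
read as the rising factorial `(f-c)_l`. -/
noncomputable def auxTermRatio (c m f : ℂ) (l : ℕ) : ℂ :=
  (ascPochhammer ℂ l).eval (f - c) * (-1) ^ l /
    (Complex.Gamma (2 - c + l) * Complex.Gamma (l + 1) * Complex.Gamma (m - 1 - l) * (1 - c + l))

open Filter Topology Asymptotics Complex
open scoped Nat

/-! Put `p = m - 1` and `g = f - 1`. The quotient `(c)_l / Γ(p+1+l)` is, up to the factor `p - c`, a
difference of consecutive values of `(c)_l / Γ(p+l)`, and `ψ(g+l+1) - ψ(g+l) = 1/(g+l)`. Summation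
by parts (`hasSum_digamma`) therefore removes the digamma function and leaves `L = ∑ (c)_l /
(Γ(p+l)(g+l))`, to be identified with `closedForm` (`tsum_leftTerm`).

Both sides obey the same first-order recurrences in `p` and in `g`. For `closedForm` these are
contiguous relations of the `₃F₂` series `∑ seriesTerm`, whose inhomogeneous parts are `₂F₁` series
evaluated by `gauss_sum`. Hence the difference `D` of the two sides satisfies `D(p) = (p-g)_N
D(p+N)`, and for `Re g > 0` the right side tends to `0`: a sum over `1/Γ(p+N+l)` is governed by its
first term (`tendsto_Gamma_mul_tsum`), and `seriesLimit` gives the behaviour of the `₃F₂` series.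
That limit is read off from a partial fraction expansion when `0 < Re g < 2`, then carried to larger
`Re g` by contiguity. The `g`-recurrence extends the identity to `Re g ≤ 0` and covers `c = g + 1 +
k`. -/

namespace GammaSum

/-! ### Reciprocal Gamma function and rising factorials -/

/-- The entire function `1 / Γ`. -/
noncomputable def rGamma (z : ℂ) : ℂ := (Gamma z)⁻¹

/-- The rising factorial `(x)_l`. -/
noncomputable def poch (x : ℂ) (l : ℕ) : ℂ := (ascPochhammer ℂ l).eval x

lemma rGamma_eq_mul (z : ℂ) : rGamma z = z * rGamma (z + 1) :=
  one_div_Gamma_eq_self_mul_one_div_Gamma_add_one z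

lemma rGamma_neg_nat (n : ℕ) : rGamma (-n) = 0 := by
  simp [rGamma, Gamma_neg_nat_eq_zero]

lemma rGamma_ne_zero {z : ℂ} (hz : ∀ n : ℕ, z ≠ -n) : rGamma z ≠ 0 :=
  inv_ne_zero (Gamma_ne_zero hz)

lemma Gamma_mul_rGamma {z : ℂ} (hz : ∀ n : ℕ, z ≠ -n) : Gamma z * rGamma z = 1 :=
  mul_inv_cancel₀ (Gamma_ne_zero hz)

lemma rGamma_one : rGamma 1 = 1 := by simp [rGamma]

lemma ne_neg_nat_of_re_pos {z : ℂ} (hz : 0 < z.re) (n : ℕ) : z ≠ -n := by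
  rintro rfl
  simp at hz
  linarith [(Nat.cast_nonneg n : (0 : ℝ) ≤ n)]

@[simp] lemma poch_zero (x : ℂ) : poch x 0 = 1 := by simp [poch]

lemma poch_succ (x : ℂ) (l : ℕ) : poch x (l + 1) = poch x l * (x + l) := by
  simp [poch, ascPochhammer_succ_eval]

lemma poch_succ' (x : ℂ) (l : ℕ) : poch x (l + 1) = x * poch (x + 1) l := by
  simp [poch, ascPochhammer_succ_left]

lemma mul_poch_add_one (x : ℂ) (l : ℕ) : x * poch (x + 1) l = poch x l * (x + l) := by
  rw [← poch_succ', poch_succ]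

lemma rGamma_eq_poch_mul (x : ℂ) (n : ℕ) : rGamma x = poch x n * rGamma (x + n) := by
  induction n with
  | zero => simp
  | succ n ih =>
    rw [ih, poch_succ, rGamma_eq_mul (x + n)]
    push_cast
    ring_nf

lemma Gamma_add_nat {x : ℂ} (hx : ∀ n : ℕ, x ≠ -n) (n : ℕ) :
    Gamma (x + n) = poch x n * Gamma x := by
  rw [poch, ← Gamma_add_nat_div_Gamma_eq x hx, div_mul_cancel₀ _ (Gamma_ne_zero hx)]

lemma add_nat_ne_neg_nat {x : ℂ} (hx : ∀ n : ℕ, x ≠ -n) (k n : ℕ) : x + k ≠ -n := by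
  intro h
  apply hx (n + k)
  push_cast
  linear_combination h

lemma add_nat_ne_zero {x : ℂ} (hx : ∀ n : ℕ, x ≠ -n) (k : ℕ) : x + k ≠ 0 := by
  simpa using add_nat_ne_neg_nat hx k 0

/-! ### Asymptotics along the natural numbers -/

lemma eventually_re_add_nat_pos (y : ℂ) : ∀ᶠ n : ℕ in atTop, 0 < (y + n).re := by
  filter_upwards [eventually_gt_atTop ⌈-y.re⌉₊] with n hn
  have := Nat.lt_of_ceil_lt hn
  simp; linarith

lemma tendsto_add_nat_div (y : ℂ) :
    Tendsto (fun n : ℕ => (y + n) / (n : ℂ)) atTop (𝓝 1) := by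
  have := (tendsto_natCast_div_add_atTop (𝕜 := ℂ) y).inv₀ one_ne_zero
  simpa [add_comm] using this

lemma GammaSeq_eq {y : ℂ} (hy : ∀ n : ℕ, y ≠ -n) (n : ℕ) :
    GammaSeq y n = (n : ℂ) ^ y * n ! * (Gamma y * rGamma (y + n)) / (y + n) := by
  have hprod : ∏ j ∈ Finset.range (n + 1), (y + j) = poch y (n + 1) := by
    induction n with
    | zero => simp [poch_succ]
    | succ n ih => rw [Finset.prod_range_succ, ih, poch_succ y (n + 1)]
  have h1 := rGamma_eq_poch_mul y n
  have h2 := Gamma_mul_rGamma hy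
  have h3 : poch y n ≠ 0 := by
    intro h
    rw [h, zero_mul] at h1
    exact rGamma_ne_zero hy h1
  rw [GammaSeq, hprod, poch_succ, ← div_div]
  congr 1
  rw [div_eq_iff h3]
  rw [h1] at h2
  linear_combination -((n : ℂ) ^ y * n !) * h2

/-- Euler's limit `GammaSeq y n → Γ(y)`, with the product in its denominator rewritten as a Gamma
quotient. -/
lemma tendsto_rGamma_of_re_pos {y : ℂ} (hy : 0 < y.re) :
    Tendsto (fun n : ℕ => rGamma (y + n) * n ! * (n : ℂ) ^ (y - 1)) atTop (𝓝 1) := by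
  have hy' := ne_neg_nat_of_re_pos hy
  have h := ((GammaSeq_tendsto_Gamma y).mul_const (rGamma y)).mul (tendsto_add_nat_div y)
  rw [Gamma_mul_rGamma hy', one_mul] at h
  refine h.congr' ?_
  filter_upwards [eventually_ne_atTop 0] with n hn
  have hn' : (n : ℂ) ≠ 0 := Nat.cast_ne_zero.2 hn
  have h2 := Gamma_mul_rGamma hy'
  have h3 := add_nat_ne_zero hy' n
  rw [GammaSeq_eq hy', cpow_sub _ _ hn', cpow_one]
  field_simp
  linear_combination ((n : ℂ) ^ y * n ! * rGamma (y + n)) * h2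

/-- The functional equation moves `y` to the right by units; each unit costs a factor `(y + n) / n →
1`. -/
theorem tendsto_rGamma_add_nat (y : ℂ) :
    Tendsto (fun n : ℕ => rGamma (y + n) * n ! * (n : ℂ) ^ (y - 1)) atTop (𝓝 1) := by
  obtain ⟨k, hk⟩ := exists_nat_gt (-y.re)
  induction k generalizing y with
  | zero => exact tendsto_rGamma_of_re_pos (by simpa using hk)
  | succ k ih =>
    have h := (ih (y + 1) (by simp at hk ⊢; linarith)).mul (tendsto_add_nat_div y)
    rw [one_mul] at h
    refine h.congr' ?_
    filter_upwards [eventually_ne_atTop 0] with n hn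
    have hn' : (n : ℂ) ≠ 0 := Nat.cast_ne_zero.2 hn
    rw [rGamma_eq_mul (y + n), show y + 1 - 1 = (y - 1) + 1 by ring, cpow_add _ _ hn', cpow_one,
      show y + 1 + n = y + n + 1 by ring]
    field_simp

theorem tendsto_Gamma_add_nat (y : ℂ) :
    Tendsto (fun n : ℕ => Gamma (y + n) / n ! * (n : ℂ) ^ (1 - y)) atTop (𝓝 1) := by
  have h := (tendsto_rGamma_add_nat y).inv₀ one_ne_zero
  rw [inv_one] at h
  refine h.congr fun n => ?_
  rw [show (1 - y) = -(y - 1) by ring, cpow_neg, rGamma]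
  simp [div_eq_mul_inv]
  ring

/-- With the limit written as `1 / Γ(s)` the poles of `Γ` need no exception: there the rising
factorial is eventually `0`. -/
theorem tendsto_poch (s : ℂ) :
    Tendsto (fun n : ℕ => poch s n / n ! * (n : ℂ) ^ (1 - s)) atTop (𝓝 (rGamma s)) := by
  have h := (tendsto_Gamma_add_nat s).const_mul (rGamma s)
  rw [mul_one] at h
  refine h.congr' ?_
  filter_upwards [eventually_re_add_nat_pos s] with n hn
  have := Gamma_mul_rGamma (ne_neg_nat_of_re_pos hn)
  rw [rGamma_eq_poch_mul s n]
  linear_combination (poch s n / n ! * (n : ℂ) ^ (1 - s)) * this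

lemma isBigO_of_tendsto_mul_cpow {f : ℕ → ℂ} {w L : ℂ} {r : ℝ}
    (h : Tendsto (fun n : ℕ => f n * (n : ℂ) ^ w) atTop (𝓝 L)) (hr : r = -w.re) :
    f =O[atTop] fun n : ℕ => (n : ℝ) ^ r := by
  have h2 : (fun n : ℕ => f n) =O[atTop] fun n : ℕ => (f n * (n : ℂ) ^ w) * ((n : ℝ) ^ r : ℝ) := by
    refine IsBigO.of_bound 1 ?_
    filter_upwards [eventually_gt_atTop 0] with n hn
    have hn' : (0 : ℝ) < n := Nat.cast_pos.2 hn
    have hnc := norm_natCast_cpow_of_pos hn w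
    rw [one_mul, norm_mul, norm_mul, hnc, Complex.norm_real,
      Real.norm_of_nonneg (Real.rpow_nonneg hn'.le _), mul_assoc, ← Real.rpow_add hn', hr]
    simp
  refine h2.trans ?_
  have h3 := (h.isBigO_one ℝ).mul
    (IsBigO.of_norm_le (f := fun n : ℕ => (((n : ℝ) ^ r : ℝ) : ℂ)) (g := fun n : ℕ => (n : ℝ) ^ r)
      (l := atTop) fun n => by
        rw [Complex.norm_real, Real.norm_of_nonneg (Real.rpow_nonneg (Nat.cast_nonneg n) _)])
  simpa using h3

lemma isBigO_rGamma (y : ℂ) {r : ℝ} (hr : r = 1 - y.re) :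
    (fun n : ℕ => rGamma (y + n) * n !) =O[atTop] fun n : ℕ => (n : ℝ) ^ r :=
  isBigO_of_tendsto_mul_cpow (tendsto_rGamma_add_nat y) (by simp [hr])

lemma isBigO_Gamma (y : ℂ) {r : ℝ} (hr : r = y.re - 1) :
    (fun n : ℕ => Gamma (y + n) / n !) =O[atTop] fun n : ℕ => (n : ℝ) ^ r :=
  isBigO_of_tendsto_mul_cpow (tendsto_Gamma_add_nat y) (by simp [hr])

lemma isBigO_poch (s : ℂ) {r : ℝ} (hr : r = s.re - 1) :
    (fun n : ℕ => poch s n / n !) =O[atTop] fun n : ℕ => (n : ℝ) ^ r :=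
  isBigO_of_tendsto_mul_cpow (tendsto_poch s) (by simp [hr])

lemma isBigO_inv_add (z : ℂ) :
    (fun n : ℕ => (z + n)⁻¹) =O[atTop] fun n : ℕ => (n : ℝ) ^ (-1 : ℝ) := by
  have h := (tendsto_add_nat_div z).inv₀ one_ne_zero
  refine isBigO_of_tendsto_mul_cpow (w := 1) (L := 1⁻¹) (h.congr fun n => ?_) (by simp)
  simp [div_eq_mul_inv, mul_comm]

lemma isBigO_mul_rpow {f g : ℕ → ℂ} {a b c : ℝ} (hf : f =O[atTop] fun n : ℕ => (n : ℝ) ^ a)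
    (hg : g =O[atTop] fun n : ℕ => (n : ℝ) ^ b) (hc : c = a + b) :
    (fun n => f n * g n) =O[atTop] fun n : ℕ => (n : ℝ) ^ c := by
  refine (hf.mul hg).congr' EventuallyEq.rfl ?_
  filter_upwards [eventually_gt_atTop 0] with n hn
  rw [hc, Real.rpow_add (Nat.cast_pos.2 hn)]

lemma summable_of_isBigO_rpow {f : ℕ → ℂ} {a : ℝ} (hf : f =O[atTop] fun n : ℕ => (n : ℝ) ^ a)
    (ha : a < -1) : Summable f :=
  summable_of_isBigO_nat (Real.summable_nat_rpow.2 ha) hf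

lemma tendsto_zero_of_isBigO_rpow {f : ℕ → ℂ} {a : ℝ}
    (hf : f =O[atTop] fun n : ℕ => (n : ℝ) ^ a) (ha : a < 0) : Tendsto f atTop (𝓝 0) := by
  refine hf.trans_tendsto ?_
  have := (tendsto_rpow_neg_atTop (y := -a) (by linarith)).comp tendsto_natCast_atTop_atTop
  simpa [Function.comp_def] using this

lemma isBigO_poch_mul_rGamma (s y : ℂ) {r : ℝ} (hr : r = (s - y).re) :
    (fun n : ℕ => poch s n * rGamma (y + n)) =O[atTop] fun n : ℕ => (n : ℝ) ^ r := by
  refine (isBigO_mul_rpow (isBigO_poch s rfl) (isBigO_rGamma y rfl) (c := r)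
    (by simp [hr])).congr_left fun n => ?_
  have : (n ! : ℂ) ≠ 0 := Nat.cast_ne_zero.2 n.factorial_ne_zero
  field_simp

lemma isBigO_Gamma_mul_rGamma (s y : ℂ) {r : ℝ} (hr : r = (s - y).re) :
    (fun n : ℕ => Gamma (s + n) * rGamma (y + n)) =O[atTop] fun n : ℕ => (n : ℝ) ^ r := by
  refine (isBigO_mul_rpow (isBigO_Gamma s rfl) (isBigO_rGamma y rfl) (c := r)
    (by simp [hr])).congr_left fun n => ?_
  have : (n ! : ℂ) ≠ 0 := Nat.cast_ne_zero.2 n.factorial_ne_zero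
  field_simp

lemma tsum_eq_of_telescope {a X : ℕ → ℂ} {L : ℂ} (hs : Summable a)
    (h : ∀ l, a l = X (l + 1) - X l) (hX : Tendsto X atTop (𝓝 L)) : ∑' l, a l = L - X 0 := by
  refine tendsto_nhds_unique hs.hasSum.tendsto_sum_nat ?_
  simp_rw [h, Finset.sum_range_sub]
  exact hX.sub_const _

/-! ### A dominated convergence statement for inverse factorial series -/

lemma norm_le_norm_add_nat {z : ℂ} (hz : 0 ≤ z.re) (N : ℕ) : ‖z‖ ≤ ‖z + N‖ := by
  rw [← sq_le_sq₀ (norm_nonneg _) (norm_nonneg _), Complex.sq_norm, Complex.sq_norm,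
    Complex.normSq_apply, Complex.normSq_apply]
  have : (0 : ℝ) ≤ N := Nat.cast_nonneg N
  simp only [add_re, natCast_re, add_im, natCast_im, add_zero]
  nlinarith

lemma norm_poch_le {y : ℂ} (hy : 0 ≤ y.re) (N l : ℕ) : ‖poch y l‖ ≤ ‖poch (y + N) l‖ := by
  induction l with
  | zero => simp
  | succ l ih =>
    rw [poch_succ, poch_succ, norm_mul, norm_mul, add_right_comm]
    refine mul_le_mul ih (norm_le_norm_add_nat ?_ N) (norm_nonneg _) (norm_nonneg _)
    simp; positivity

lemma Gamma_mul_rGamma_add_nat {y : ℂ} (hy : ∀ n : ℕ, y ≠ -n) (l : ℕ) :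
    Gamma y * rGamma (y + l) = (poch y l)⁻¹ := by
  have h := rGamma_eq_poch_mul y l
  have h2 := Gamma_mul_rGamma hy
  rw [h] at h2
  rw [← mul_eq_one_iff_eq_inv₀]
  · linear_combination h2
  · rintro h0
    rw [h0] at h2
    simp at h2

lemma summable_rGamma_add_one {q : ℕ → ℂ} {y : ℂ} (h : Summable fun l : ℕ => q l * rGamma (y + l)) :
    Summable fun l : ℕ => q l * rGamma (y + 1 + l) := by
  refine h.norm.of_norm_bounded_eventually_nat ?_
  filter_upwards [eventually_re_add_nat_pos (y - 1)] with l hl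
  have h1 : 1 ≤ ‖y + l‖ := by
    refine le_trans ?_ (re_le_norm _)
    simp at hl ⊢
    linarith
  rw [rGamma_eq_mul (y + l), norm_mul, norm_mul, norm_mul, add_right_comm]
  nlinarith [mul_nonneg (norm_nonneg (q l)) (norm_nonneg (rGamma (y + l + 1)))]

lemma summable_rGamma_add_nat {q : ℕ → ℂ} {y : ℂ} (h : Summable fun l : ℕ => q l * rGamma (y + l))
    (N : ℕ) : Summable fun l : ℕ => q l * rGamma (y + N + l) := by
  induction N with
  | zero => simpa using h
  | succ N ih =>
    have := summable_rGamma_add_one ih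
    push_cast
    rwa [← add_assoc]

/-- `Γ(y+N) / Γ(y+N+l) = 1 / (y+N)_l` is `1` for `l = 0` and tends to `0` for `l ≥ 1`. Since `Re y >
0`, `|(y+N)_l| ≥ |(y)_l|`, so the terms at `N = 0` dominate. -/
lemma tendsto_Gamma_mul_tsum_of_re_pos {q : ℕ → ℂ} {y : ℂ} (hy : 0 < y.re)
    (h : Summable fun l : ℕ => q l * rGamma (y + l)) :
    Tendsto (fun N : ℕ => Gamma (y + N) * ∑' l : ℕ, q l * rGamma (y + N + l)) atTop (𝓝 (q 0)) := by
  have hyN : ∀ N n : ℕ, y + N ≠ -n := add_nat_ne_neg_nat (ne_neg_nat_of_re_pos hy)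
  have hq : ∑' l : ℕ, (if l = 0 then q 0 else 0) = q 0 := by simp
  simp_rw [← tsum_mul_left]
  rw [← hq]
  refine tendsto_tsum_of_dominated_convergence (bound := fun l => ‖Gamma y * (q l * rGamma (y + l))‖)
    (h.mul_left _).norm (fun l => ?_) (Eventually.of_forall fun N l => ?_)
  · rcases Nat.eq_zero_or_pos l with rfl | hl
    · simp only [Nat.cast_zero, add_zero, if_true]
      refine tendsto_const_nhds.congr fun N => ?_
      linear_combination (-q 0) * Gamma_mul_rGamma (hyN N)
    · rw [if_neg hl.ne']
      have h0 := tendsto_zero_of_isBigO_rpow (isBigO_Gamma_mul_rGamma y (y + l) (r := -(l : ℝ))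
        (by simp)) (by simpa using hl)
      have := h0.const_mul (q l)
      rw [mul_zero] at this
      refine this.congr fun N => ?_
      rw [add_right_comm]
      ring
  · have h1 : ∀ z : ℂ, Gamma z * (q l * rGamma (z + l)) = q l * (Gamma z * rGamma (z + l)) := by
      intro z; ring
    rw [h1, h1, Gamma_mul_rGamma_add_nat (hyN N),
      Gamma_mul_rGamma_add_nat (ne_neg_nat_of_re_pos hy), norm_mul, norm_mul, norm_inv, norm_inv]
    have hpos : 0 < ‖poch y l‖ := by
      rw [norm_pos_iff]
      intro h0
      have h2 := Gamma_mul_rGamma_add_nat (ne_neg_nat_of_re_pos hy) l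
      rw [h0, inv_zero] at h2
      exact mul_ne_zero (Gamma_ne_zero (ne_neg_nat_of_re_pos hy))
        (rGamma_ne_zero (add_nat_ne_neg_nat (ne_neg_nat_of_re_pos hy) l)) h2
    gcongr
    exact norm_poch_le hy.le N l

theorem tendsto_Gamma_mul_tsum {q : ℕ → ℂ} {y : ℂ}
    (h : Summable fun l : ℕ => q l * rGamma (y + l)) :
    Tendsto (fun N : ℕ => Gamma (y + N) * ∑' l : ℕ, q l * rGamma (y + N + l)) atTop (𝓝 (q 0)) := by
  obtain ⟨M, hM⟩ := (eventually_re_add_nat_pos y).exists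
  have := tendsto_Gamma_mul_tsum_of_re_pos hM (summable_rGamma_add_nat h M)
  rw [← tendsto_add_atTop_iff_nat M]
  refine this.congr fun N => ?_
  push_cast
  rw [show y + (N + M : ℂ) = y + M + N by ring]

/-! ### The coefficients `(-1)^l / (l! Γ(p - l))` -/

/-- The binomial coefficients `(-1)^l / (l! Γ(p - l)) = (1 - p)_l / (l! Γ(p))`. -/
noncomputable def binomCoeff (p : ℂ) (l : ℕ) : ℂ := (-1) ^ l * rGamma (l + 1) * rGamma (p - l)

lemma binomCoeff_zero (p : ℂ) : binomCoeff p 0 = rGamma p := by simp [binomCoeff, rGamma_one]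

lemma binomCoeff_succ (p : ℂ) (l : ℕ) :
    (l + 1) * binomCoeff p (l + 1) = -(p - 1 - l) * binomCoeff p l := by
  rw [binomCoeff, binomCoeff, rGamma_eq_mul (l + 1), rGamma_eq_mul (p - (l + 1 : ℕ))]
  push_cast
  rw [show p - (l + 1) + 1 = p - l by ring, pow_succ]
  ring

lemma binomCoeff_add_one (p : ℂ) (l : ℕ) : (p - l) * binomCoeff (p + 1) l = binomCoeff p l := by
  rw [binomCoeff, binomCoeff, rGamma_eq_mul (p - l), show p + 1 - l = p - l + 1 by ring]
  ring

lemma binomCoeff_eq (p : ℂ) (l : ℕ) : binomCoeff p l = rGamma p * (poch (1 - p) l / l !) := by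
  induction l with
  | zero => simp [binomCoeff_zero]
  | succ l ih =>
    have h := binomCoeff_succ p l
    have h1 : (l ! : ℂ) ≠ 0 := Nat.cast_ne_zero.2 l.factorial_ne_zero
    have h2 : (l + 1 : ℂ) ≠ 0 := Nat.cast_add_one_ne_zero l
    rw [← mul_right_inj' h2, h, ih, poch_succ, Nat.factorial_succ]
    push_cast
    field_simp
    ring

lemma isBigO_binomCoeff (p : ℂ) :
    (fun n : ℕ => binomCoeff p n) =O[atTop] fun n : ℕ => (n : ℝ) ^ (-p.re) := by
  simp_rw [binomCoeff_eq]
  exact (isBigO_poch (1 - p) (by simp)).const_mul_left _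

lemma binomCoeff_intCast_eq_zero (n : ℤ) {l : ℕ} (hl : n ≤ l) : binomCoeff n l = 0 := by
  obtain ⟨k, hk⟩ := Int.eq_ofNat_of_zero_le (sub_nonneg.2 hl)
  have : (n : ℂ) - l = -(k : ℕ) := by
    have : (n : ℤ) - l = -(k : ℤ) := by linarith
    exact_mod_cast congrArg (Int.cast : ℤ → ℂ) this
  rw [binomCoeff, this, rGamma_neg_nat, mul_zero]

/-- A sequence weighted by `binomCoeff p` is `O(n ^ a)` for every `a` if `p` is an integer. -/
lemma isBigO_binomCoeff_mul {f : ℕ → ℂ} {p : ℂ} {a b : ℝ}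
    (hf : f =O[atTop] fun n : ℕ => (n : ℝ) ^ a) (hp : (∃ n : ℤ, p = n) ∨ a - p.re ≤ b) :
    (fun n => f n * binomCoeff p n) =O[atTop] fun n : ℕ => (n : ℝ) ^ b := by
  rcases hp with ⟨k, rfl⟩ | hp
  · refine IsBigO.of_bound 1 ?_
    filter_upwards [eventually_ge_atTop k.toNat] with n hn
    rw [binomCoeff_intCast_eq_zero k (by omega), mul_zero, norm_zero]
    positivity
  · refine (isBigO_mul_rpow hf (isBigO_binomCoeff p) (sub_eq_add_neg a p.re)).trans ?_
    refine IsBigO.of_bound 1 ?_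
    filter_upwards [eventually_ge_atTop 1] with n hn
    rw [one_mul, Real.norm_of_nonneg (by positivity), Real.norm_of_nonneg (by positivity)]
    exact Real.rpow_le_rpow_of_exponent_le (by exact_mod_cast hn) hp

/-! ### Gauss's summation theorem -/

/-- The general term of the Gauss series `₂F₁(x, 1 - p; y; 1) / (Γ(y) Γ(p))`. -/
noncomputable def gaussTerm (x y p : ℂ) (l : ℕ) : ℂ := poch x l * rGamma (y + l) * binomCoeff p l

/-- The terms have order `Re (x - y - p)` unless integrality of `p` terminates the series. An
exponent strictly below `-1` also makes `l` times the term tend to `0`, as telescoping requires. -/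
lemma exists_isBigO_gaussTerm {x y p : ℂ} (h : (∃ n : ℤ, p = n) ∨ 0 < (y - x + p - 1).re) :
    ∃ b < (-1 : ℝ), gaussTerm x y p =O[atTop] fun n : ℕ => (n : ℝ) ^ b := by
  rcases h with h | h
  · exact ⟨-2, by norm_num, isBigO_binomCoeff_mul (isBigO_poch_mul_rGamma x y rfl) (Or.inl h)⟩
  · refine ⟨(x - y).re - p.re, ?_,
      isBigO_binomCoeff_mul (isBigO_poch_mul_rGamma x y rfl) (Or.inr le_rfl)⟩
    simp at h ⊢
    linarith

lemma summable_gaussTerm {x y p : ℂ} (h : (∃ n : ℤ, p = n) ∨ 0 < (y - x + p - 1).re) :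
    Summable (gaussTerm x y p) := by
  obtain ⟨b, hb, hO⟩ := exists_isBigO_gaussTerm h
  exact summable_of_isBigO_rpow hO hb

lemma isBigO_natCast : (fun n : ℕ => (n : ℂ)) =O[atTop] fun n : ℕ => (n : ℝ) ^ (1 : ℝ) :=
  IsBigO.of_norm_le fun n => by simp

lemma gaussCond_add_one {x y p : ℂ} (h : (∃ n : ℤ, p = n) ∨ 0 < (y - x + p - 1).re) :
    (∃ n : ℤ, p = n) ∨ 0 < (y + 1 - x + p - 1).re :=
  h.imp_right fun h => by simp at h ⊢; linarith

/-- Contiguous relation in `y`: the difference of the two sides telescopes, with certificate `-l *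
gaussTerm x y p l`. -/
lemma gauss_step {x y p : ℂ} (h : (∃ n : ℤ, p = n) ∨ 0 < (y - x + p - 1).re) :
    (y - x + p - 1) * ∑' l, gaussTerm x y p l
      = (y - x) * (y + p - 1) * ∑' l, gaussTerm x (y + 1) p l := by
  obtain ⟨b, hb, hO⟩ := exists_isBigO_gaussTerm h
  have hs := summable_gaussTerm h
  have hs' := summable_gaussTerm (gaussCond_add_one h)
  have hX : Tendsto (fun l : ℕ => -((l : ℂ) * gaussTerm x y p l)) atTop (𝓝 0) := by
    have := (tendsto_zero_of_isBigO_rpow (isBigO_mul_rpow isBigO_natCast hO rfl)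
      (by linarith)).neg
    simpa using this
  have := tsum_eq_of_telescope ((hs.mul_left (y - x + p - 1)).sub
    (hs'.mul_left ((y - x) * (y + p - 1)))) (fun l => ?_) hX
  · rw [Summable.tsum_sub (hs.mul_left _) (hs'.mul_left _), tsum_mul_left, tsum_mul_left] at this
    simpa [sub_eq_zero] using this
  · have h1 := binomCoeff_succ p l
    have h2 := rGamma_eq_mul (y + l)
    simp only [gaussTerm]
    push_cast
    rw [poch_succ, h2, show y + (l + 1) = y + l + 1 by ring, show y + 1 + l = y + l + 1 by ring]
    linear_combination (poch x l * (x + l) * rGamma (y + l + 1)) * h1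

lemma gauss_iterate {x y p : ℂ} (h : (∃ n : ℤ, p = n) ∨ 0 < (y - x + p - 1).re) (N : ℕ) :
    rGamma (y - x + p - 1) * ∑' l, gaussTerm x y p l
      = poch (y - x) N * poch (y + p - 1) N * rGamma (y - x + p - 1 + N) *
        ∑' l, gaussTerm x (y + N) p l := by
  induction N generalizing y with
  | zero => simp
  | succ N ih =>
    have h1 := ih (gaussCond_add_one h)
    have h2 := gauss_step h
    rw [rGamma_eq_mul, poch_succ', poch_succ']
    push_cast
    rw [show y - x + p - 1 + 1 = y + 1 - x + p - 1 by ring,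
      show y - x + 1 = y + 1 - x by ring, show y + p - 1 + 1 = y + 1 + p - 1 by ring,
      show y - x + p - 1 + (N + 1) = y + 1 - x + p - 1 + N by ring,
      show y + (N + 1 : ℂ) = y + 1 + N by ring]
    linear_combination rGamma (y + 1 - x + p - 1) * h2 + (y - x) * (y + p - 1) * h1

/-- Gauss's summation theorem for `₂F₁(x, 1 - p; y; 1)`. -/
theorem gauss_sum {x y p : ℂ} (h : (∃ n : ℤ, p = n) ∨ 0 < (y - x + p - 1).re) :
    rGamma (y - x + p - 1) * ∑' l, gaussTerm x y p l
      = rGamma (y - x) * rGamma (y + p - 1) * rGamma p := by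
  -- As `y` is shifted to infinity only the term `l = 0` survives.
  have hlim : Tendsto (fun N : ℕ => Gamma (y + N) * ∑' l, gaussTerm x (y + N) p l) atTop
      (𝓝 (rGamma p)) := by
    have hq : Summable fun l : ℕ => (poch x l * binomCoeff p l) * rGamma (y + l) :=
      (summable_gaussTerm h).congr fun l => by rw [gaussTerm]; ring
    have := tendsto_Gamma_mul_tsum hq
    rw [poch_zero, one_mul, binomCoeff_zero] at this
    refine this.congr fun N => ?_
    congr 1
    exact tsum_congr fun l => by rw [gaussTerm]; ring
  -- The factorials cancel and the four exponents of `N` add up to `0`, so the bare coefficient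
  -- divided by `Γ(y+N)` has the same limit.
  have hcoef := ((tendsto_poch (y - x)).mul (tendsto_poch (y + p - 1))).mul
    ((tendsto_rGamma_add_nat (y - x + p - 1)).mul (tendsto_rGamma_add_nat y))
  have := hcoef.mul hlim
  rw [mul_one, mul_one] at this
  refine tendsto_nhds_unique (tendsto_const_nhds.congr' ?_) this
  filter_upwards [eventually_re_add_nat_pos y, eventually_ne_atTop 0] with N hN hN0
  have hN0' : (N : ℂ) ≠ 0 := Nat.cast_ne_zero.2 hN0
  have hf : (N ! : ℂ) ≠ 0 := Nat.cast_ne_zero.2 N.factorial_ne_zero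
  have h1 := Gamma_mul_rGamma (ne_neg_nat_of_re_pos hN)
  have h2 : (N : ℂ) ^ (1 - (y - x)) * (N : ℂ) ^ (1 - (y + p - 1)) * (N : ℂ) ^ (y - x + p - 1 - 1) *
      (N : ℂ) ^ (y - 1) = 1 := by
    rw [← cpow_add _ _ hN0', ← cpow_add _ _ hN0', ← cpow_add _ _ hN0',
      show (1 - (y - x)) + (1 - (y + p - 1)) + (y - x + p - 1 - 1) + (y - 1) = 0 by ring, cpow_zero]
  rw [gauss_iterate h N]
  generalize (∑' l, gaussTerm x (y + N) p l) = G
  calc poch (y - x) N * poch (y + p - 1) N * rGamma (y - x + p - 1 + N) * G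
      = poch (y - x) N * poch (y + p - 1) N * rGamma (y - x + p - 1 + N) * G *
        (Gamma (y + N) * rGamma (y + N)) * ((N : ℂ) ^ (1 - (y - x)) *
          (N : ℂ) ^ (1 - (y + p - 1)) * (N : ℂ) ^ (y - x + p - 1 - 1) * (N : ℂ) ^ (y - 1)) := by
        rw [h1, h2, mul_one, mul_one]
    _ = _ := by
        field_simp

/-- The partial fraction expansion of a quotient of Gamma functions, in the form
`∑ (q)_j / (j! (w + j)) = B(w, 1 - q)`. -/
theorem tsum_poch_div {q w : ℂ} (hq : q.re < 1) (hw : ∀ n : ℕ, w ≠ -n) :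
    ∑' j : ℕ, poch q j / j ! * (w + j)⁻¹ = Gamma w * Gamma (1 - q) * rGamma (w + 1 - q) := by
  have hq' : 0 < (1 - q).re := by simpa using hq
  -- With `x = w`, `y = w + 1` the factor `(w)_j / Γ(w+1+j)` collapses to `1 / (Γ(w)(w+j))`.
  have hG := gauss_sum (x := w) (y := w + 1) (p := 1 - q) (Or.inr (by simpa using hq))
  have hterm : ∀ j, gaussTerm w (w + 1) (1 - q) j
      = rGamma (1 - q) * rGamma w * (poch q j / j ! * (w + j)⁻¹) := fun j => by
    have h0 := add_nat_ne_zero hw j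
    rw [gaussTerm, binomCoeff_eq, rGamma_eq_poch_mul w j, rGamma_eq_mul (w + j),
      show w + 1 + j = w + j + 1 by ring, show 1 - (1 - q) = q by ring]
    field_simp
  simp_rw [hterm] at hG
  rw [tsum_mul_left, show w + 1 - w + (1 - q) - 1 = 1 - q by ring,
    show w + 1 + (1 - q) - 1 = w + 1 - q by ring, show w + 1 - w = 1 by ring, rGamma_one] at hG
  have h1 := Gamma_mul_rGamma (ne_neg_nat_of_re_pos hq')
  have h2 := Gamma_mul_rGamma hw
  generalize (∑' j : ℕ, poch q j / j ! * (w + j)⁻¹) = S at *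
  linear_combination (Gamma w * Gamma (1 - q) ^ 2) * hG
    - (S * (Gamma (1 - q) * rGamma (1 - q) + 1) * (Gamma w * rGamma w)
      - Gamma w * Gamma (1 - q) * rGamma (w + 1 - q)) * h1 - S * h2

/-- The expansion `∑ (-1)^l / (l! Γ(p - l) (z + l)) = Γ(z) / Γ(p + z)`. -/
theorem tsum_binomCoeff_div {p z : ℂ} (hp : 0 < p.re) (hz : ∀ n : ℕ, z ≠ -n) :
    ∑' l : ℕ, binomCoeff p l * (z + l)⁻¹ = Gamma z * rGamma (p + z) := by
  have h := tsum_poch_div (q := 1 - p) (by simpa using hp) hz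
  have h1 := Gamma_mul_rGamma (ne_neg_nat_of_re_pos hp)
  simp_rw [binomCoeff_eq, mul_assoc, tsum_mul_left]
  rw [h, show 1 - (1 - p) = p by ring, show z + 1 - (1 - p) = p + z by ring]
  linear_combination (Gamma z * rGamma (p + z)) * h1

lemma ne_neg_nat_of_ne_int {z : ℂ} (hz : ∀ n : ℤ, z ≠ n) (n : ℕ) : z ≠ -n := by
  have := hz (-n)
  push_cast at this
  exact this

lemma int_sub_ne_int {z : ℂ} (hz : ∀ n : ℤ, z ≠ n) (k n : ℤ) : k - z ≠ n := by
  intro h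
  apply hz (k - n)
  push_cast
  linear_combination -h

lemma add_int_ne_int {z : ℂ} (hz : ∀ n : ℤ, z ≠ n) (k n : ℤ) : z + k ≠ n := by
  intro h
  apply hz (n - k)
  push_cast
  linear_combination h

lemma one_sub_ne_neg_nat {c : ℂ} (hc : ∀ n : ℤ, c ≠ n) (n : ℕ) : 1 - c ≠ -n :=
  ne_neg_nat_of_ne_int (by simpa using int_sub_ne_int hc 1) n

/-! ### The terminating or convergent `₃F₂` series -/

/-- The general term of `auxTerm c (p + 1) (g + 1)`, divided by `Γ(g + 1 - c)`. -/
noncomputable def seriesTerm (c p g : ℂ) (l : ℕ) : ℂ :=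
  poch (g + 1 - c) l * rGamma (2 - c + l) * (1 - c + l)⁻¹ * binomCoeff p l

lemma summable_seriesTerm {c p g : ℂ} (h : (∃ n : ℤ, p = n) ∨ -1 < (p - g).re) :
    Summable (seriesTerm c p g) := by
  have h1 := isBigO_mul_rpow (isBigO_poch_mul_rGamma (g + 1 - c) (2 - c) rfl)
    (isBigO_inv_add (1 - c)) (c := g.re - 2) (by simp; ring)
  rcases h with h | h
  · exact summable_of_isBigO_rpow (isBigO_binomCoeff_mul (b := -2) h1 (Or.inl h)) (by norm_num)
  · refine summable_of_isBigO_rpow (isBigO_binomCoeff_mul h1 (Or.inr le_rfl)) ?_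
    simp at h
    linarith

/-- Split `p + 1 - c = (p - l) + (1 - c + l)`: the first part lowers `p + 1` to `p` in the binomial
coefficient, the second cancels the denominator and leaves a Gauss term. -/
lemma series_add_one_right {c p g : ℂ} (hc : ∀ n : ℤ, c ≠ n)
    (h : (∃ n : ℤ, p = n) ∨ -1 < (p - g).re) :
    (p + 1 - c) * ∑' l, seriesTerm c (p + 1) g l - ∑' l, seriesTerm c p g l
      = ∑' l, gaussTerm (g + 1 - c) (2 - c) (p + 1) l := by
  have h' : (∃ n : ℤ, p + 1 = n) ∨ -1 < (p + 1 - g).re := by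
    refine h.imp (fun ⟨n, hn⟩ => ⟨n + 1, by rw [hn]; push_cast; rfl⟩) fun h => ?_
    simp at h ⊢; linarith
  rw [← tsum_mul_left, ← Summable.tsum_sub ((summable_seriesTerm h').mul_left _)
    (summable_seriesTerm h)]
  refine tsum_congr fun l => ?_
  have h0 := add_nat_ne_zero (one_sub_ne_neg_nat hc) l
  rw [seriesTerm, seriesTerm, gaussTerm, ← binomCoeff_add_one p l]
  field_simp
  ring

/-- Termwise, from `(x)(x+1)_l = (x)_l (x+l)` at `x = g + 1 - c` and `x + l = g + (1 - c + l)`. -/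
lemma series_g_add_one {c p g : ℂ} (hc : ∀ n : ℤ, c ≠ n)
    (h : (∃ n : ℤ, p = n) ∨ 0 < (p - g).re) :
    (g + 1 - c) * ∑' l, seriesTerm c p (g + 1) l
      = g * ∑' l, seriesTerm c p g l + ∑' l, gaussTerm (g + 1 - c) (2 - c) p l := by
  have h1 : (∃ n : ℤ, p = n) ∨ -1 < (p - g).re := h.imp_right fun h => by linarith
  have hG : (∃ n : ℤ, p = n) ∨ 0 < (2 - c - (g + 1 - c) + p - 1).re := by
    rwa [show 2 - c - (g + 1 - c) + p - 1 = p - g by ring]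
  rw [← tsum_mul_left, ← tsum_mul_left, ← Summable.tsum_add
    ((summable_seriesTerm h1).mul_left _) (summable_gaussTerm hG)]
  refine tsum_congr fun l => ?_
  have h0 := add_nat_ne_zero (one_sub_ne_neg_nat hc) l
  have h2 := mul_poch_add_one (g + 1 - c) l
  rw [seriesTerm, seriesTerm, gaussTerm, show g + 1 + 1 - c = g + 1 - c + 1 by ring]
  field_simp
  linear_combination (rGamma (2 - c + l) * binomCoeff p l) * h2

lemma series_c_add_one {c p g : ℂ} (hc : ∀ n : ℤ, c ≠ n)
    (h : (∃ n : ℤ, p = n) ∨ 0 < (p - g).re) :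
    c * ∑' l, seriesTerm (c + 1) p g l
      = (g - c) * (-(p - c) * ∑' l, seriesTerm c p g l
        + ∑' l, gaussTerm (g + 1 - c) (2 - c) p l) - ∑' l, gaussTerm (g - c) (1 - c) p l := by
  have h1 : (∃ n : ℤ, p = n) ∨ -1 < (p - g).re := h.imp_right fun h => by linarith
  have hG : (∃ n : ℤ, p = n) ∨ 0 < (2 - c - (g + 1 - c) + p - 1).re := by
    rwa [show 2 - c - (g + 1 - c) + p - 1 = p - g by ring]
  have hG' : (∃ n : ℤ, p = n) ∨ 0 < (1 - c - (g - c) + p - 1).re := by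
    rwa [show 1 - c - (g - c) + p - 1 = p - g by ring]
  have hs := ((summable_seriesTerm (c := c + 1) h1).mul_left c).add (summable_gaussTerm hG')
  rw [eq_sub_iff_add_eq, ← tsum_mul_left, ← Summable.tsum_add
    ((summable_seriesTerm h1).mul_left _) (summable_gaussTerm hG'), hs.tsum_eq_zero_add,
    ← tsum_mul_left, ← Summable.tsum_add
    ((summable_seriesTerm h1).mul_left _) (summable_gaussTerm hG), ← tsum_mul_left]
  have hc0 : c ≠ 0 := by simpa using hc 0
  -- The left-hand terms must be shifted by one index to match the right; the leftover terms at
  -- index `0` cancel.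
  have hzero : c * seriesTerm (c + 1) p g 0 + gaussTerm (g - c) (1 - c) p 0 = 0 := by
    rw [seriesTerm, gaussTerm]
    simp only [poch_zero, Nat.cast_zero, add_zero]
    rw [show 2 - (c + 1) = 1 - c by ring, show 1 - (c + 1) = -c by ring]
    field_simp
    ring
  rw [hzero, zero_add]
  refine tsum_congr fun l => ?_
  have h0 := add_nat_ne_zero (one_sub_ne_neg_nat hc) l
  have h2 := binomCoeff_succ p l
  rw [seriesTerm, seriesTerm, gaussTerm, gaussTerm]
  push_cast
  rw [show g + 1 - (c + 1) = g - c by ring, show 2 - (c + 1) + (l + 1) = 2 - c + l by ring,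
    show 1 - c + (l + 1 : ℂ) = 2 - c + l by ring,
    show 1 - (c + 1) + (l + 1 : ℂ) = 1 - c + l by ring, poch_succ',
    show g - c + 1 = g + 1 - c by ring]
  field_simp
  linear_combination ((g - c) * poch (g + 1 - c) l * rGamma (2 - c + l)) * h2

/-! ### Partial fractions of the coefficients and the base strip `0 < Re g < 2` -/

lemma summable_poch_div {q : ℂ} (hq : q.re < 1) (w : ℂ) :
    Summable fun j : ℕ => poch q j / j ! * (w + j)⁻¹ :=
  summable_of_isBigO_rpow (isBigO_mul_rpow (isBigO_poch q rfl) (isBigO_inv_add w) rfl)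
    (by linarith)

/-- Partial fractions in `z`, with poles at `0` and `-g - j`. Writing `(g)_j` through `(g-1)_j`
reduces the sum to two Beta expansions with `q = g - 1`, which is why `Re g < 2` suffices. -/
lemma gamma_quotient_eq_tsum {g z : ℂ} (hg : ∀ n : ℤ, g ≠ n) (hg2 : g.re < 2)
    (hz : z ≠ 0) (hgz : ∀ n : ℕ, g + z ≠ -n) :
    Gamma (g + z) * rGamma (1 + z) * z⁻¹ = Gamma g * z⁻¹
      - rGamma (1 - g) * ∑' j : ℕ, poch g j / j ! * (g + j)⁻¹ * (g + z + j)⁻¹ := by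
  have hq : (g - 1).re < 1 := by simp; linarith
  have hq0 : g - 1 ≠ 0 := sub_ne_zero.2 (by simpa using hg 1)
  have hg' := ne_neg_nat_of_ne_int hg
  have hterm : ∀ j : ℕ, poch g j / j ! * (g + j)⁻¹ * (g + z + j)⁻¹ = (g - 1)⁻¹ *
      (-z⁻¹ * (poch (g - 1) j / j ! * (g + j)⁻¹)
        + (1 + z) * z⁻¹ * (poch (g - 1) j / j ! * (g + z + j)⁻¹)) := fun j => by
    have h1 := add_nat_ne_zero hg' j
    have h2 := add_nat_ne_zero hgz j
    have h3 := mul_poch_add_one (g - 1) j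
    rw [sub_add_cancel] at h3
    have h4 : poch g j = (g - 1)⁻¹ * (poch (g - 1) j * (g - 1 + j)) := by
      rw [← h3, inv_mul_cancel_left₀ hq0]
    rw [h4]
    field_simp
    ring
  simp_rw [hterm]
  rw [tsum_mul_left, Summable.tsum_add ((summable_poch_div hq g).mul_left _)
    ((summable_poch_div hq (g + z)).mul_left _), tsum_mul_left, tsum_mul_left,
    tsum_poch_div hq hg', tsum_poch_div hq hgz, show 1 - (g - 1) = 2 - g by ring,
    show g + 1 - (g - 1) = 1 + 1 by ring, show g + z + 1 - (g - 1) = 1 + z + 1 by ring,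
    rGamma_eq_mul (1 + z), rGamma_eq_mul (1 - g), show 1 - g + 1 = 2 - g by ring]
  have h5 : rGamma (1 + 1) = 1 := by rw [← one_mul (rGamma _), ← rGamma_eq_mul, rGamma_one]
  have h6 : Gamma (2 - g) * rGamma (2 - g) = 1 :=
    Gamma_mul_rGamma (ne_neg_nat_of_ne_int (by simpa using int_sub_ne_int hg 2))
  rw [h5]
  field_simp
  linear_combination ((g - 1) * (Gamma g - (1 + z) * Gamma (g + z) * rGamma (1 + z + 1))) * h6

lemma exists_norm_inv_add_le (x : ℂ) :
    ∃ C : ℝ, 0 < C ∧ ∀ n : ℕ, ‖(x + n)⁻¹‖ ≤ C * ((n : ℝ) + 1)⁻¹ := by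
  have h : (fun n : ℕ => (n : ℝ) ^ (-1 : ℝ)) =O[atTop] fun n : ℕ => ((n : ℝ) + 1)⁻¹ := by
    refine IsBigO.of_bound 2 ?_
    filter_upwards [eventually_ge_atTop 1] with n hn
    have hn' : (1 : ℝ) ≤ n := by exact_mod_cast hn
    rw [Real.rpow_neg_one, Real.norm_of_nonneg (by positivity), Real.norm_of_nonneg (by positivity)]
    rw [← div_eq_mul_inv, inv_eq_one_div, div_le_div_iff₀ (by linarith) (by linarith)]
    linarith
  obtain ⟨C, hC, hb⟩ := bound_of_isBigO_nat_atTop ((isBigO_inv_add x).trans h)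
  refine ⟨C, hC, fun n => ?_⟩
  have hn : (0 : ℝ) < ((n : ℝ) + 1)⁻¹ := by positivity
  simpa [Real.norm_of_nonneg hn.le, abs_of_pos (Nat.cast_add_one_pos (α := ℝ) n)] using hb hn.ne'

lemma tsum_double_swap {g p x : ℂ} (hg2 : g.re < 2) (hp : 1 < p.re) (hx : ∀ n : ℕ, x ≠ -n) :
    Summable (fun l : ℕ => ∑' j : ℕ, poch g j / j ! * (g + j)⁻¹ * (x + l + j)⁻¹ * binomCoeff p l) ∧
    ∑' l : ℕ, ∑' j : ℕ, poch g j / j ! * (g + j)⁻¹ * (x + l + j)⁻¹ * binomCoeff p l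
      = ∑' j : ℕ, poch g j / j ! * (g + j)⁻¹ * Gamma (x + j) * rGamma (p + x + j) := by
  obtain ⟨C, hC, hb⟩ := exists_norm_inv_add_le x
  have hβ : Summable (binomCoeff p) := summable_of_isBigO_rpow (isBigO_binomCoeff p) (by linarith)
  have ha : Summable fun j : ℕ => poch g j / j ! * (g + j)⁻¹ * (1 + j : ℂ)⁻¹ :=
    summable_of_isBigO_rpow (isBigO_mul_rpow (isBigO_mul_rpow (isBigO_poch g rfl)
      (isBigO_inv_add g) rfl) (isBigO_inv_add 1) rfl) (by linarith)
  have hs : Summable fun q : ℕ × ℕ =>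
      poch g q.2 / q.2 ! * (g + q.2)⁻¹ * (x + q.1 + q.2)⁻¹ * binomCoeff p q.1 := by
    refine Summable.of_norm_bounded ((summable_mul_of_summable_norm hβ.norm ha.norm).norm.mul_left C)
      fun q => ?_
    -- This bound is uniform in the first index, so the double series is dominated by a product of
    -- two summable ones.
    have h1 : ‖(x + q.1 + q.2)⁻¹‖ ≤ C * ‖(1 + q.2 : ℂ)⁻¹‖ := by
      have h2 := hb (q.1 + q.2)
      push_cast at h2
      rw [← add_assoc] at h2
      refine h2.trans ?_
      have h3 : ‖(1 + q.2 : ℂ)⁻¹‖ = ((q.2 : ℝ) + 1)⁻¹ := by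
        rw [norm_inv, show (1 + q.2 : ℂ) = ((q.2 + 1 : ℕ) : ℂ) by push_cast; ring, norm_natCast]
        push_cast; rfl
      rw [h3]
      gcongr
      linarith [(Nat.cast_nonneg q.1 : (0 : ℝ) ≤ q.1)]
    rw [norm_mul, norm_mul, norm_mul (binomCoeff p q.1), norm_mul (poch g q.2 / _ * _)]
    calc ‖poch g q.2 / q.2 ! * (g + q.2)⁻¹‖ * ‖(x + q.1 + q.2)⁻¹‖ * ‖binomCoeff p q.1‖
        ≤ ‖poch g q.2 / q.2 ! * (g + q.2)⁻¹‖ * (C * ‖(1 + q.2 : ℂ)⁻¹‖) * ‖binomCoeff p q.1‖ := by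
          gcongr
      _ = _ := by ring
  refine ⟨hs.prod, ?_⟩
  rw [← Summable.tsum_comm (f := fun l j : ℕ =>
    poch g j / j ! * (g + j)⁻¹ * (x + l + j)⁻¹ * binomCoeff p l) hs]
  refine tsum_congr fun j => ?_
  have h := tsum_binomCoeff_div (p := p) (by linarith) (add_nat_ne_neg_nat hx j)
  calc ∑' l : ℕ, poch g j / j ! * (g + j)⁻¹ * (x + l + j)⁻¹ * binomCoeff p l
      = ∑' l : ℕ, poch g j / j ! * (g + j)⁻¹ * (binomCoeff p l * (x + j + l)⁻¹) :=
        tsum_congr fun l => by rw [add_right_comm]; ring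
    _ = _ := by rw [tsum_mul_left, h, add_assoc p]; ring

/-- Expand each term by partial fractions at `z = 1 - c + l`, then exchange the sums; both sums over
`l` are Beta expansions. -/
lemma series_eq_of_strip {c p g : ℂ} (hc : ∀ n : ℤ, c ≠ n) (hg : ∀ n : ℤ, g ≠ n)
    (hx : ∀ n : ℕ, g + 1 - c ≠ -n) (hg2 : g.re < 2) (hp : 1 < p.re) :
    ∑' l, seriesTerm c p g l = rGamma (g + 1 - c) * (Gamma g * Gamma (1 - c) * rGamma (p + 1 - c)
      - rGamma (1 - g) * ∑' j : ℕ, poch g j / j ! * (g + j)⁻¹ * Gamma (g + 1 - c + j)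
          * rGamma (p + (g + 1 - c) + j)) := by
  have hc1 := one_sub_ne_neg_nat hc
  have hβ : Summable fun l : ℕ => binomCoeff p l * (1 - c + l)⁻¹ :=
    summable_of_isBigO_rpow (isBigO_mul_rpow (isBigO_binomCoeff p) (isBigO_inv_add (1 - c)) rfl)
      (by linarith)
  obtain ⟨hs, hsum⟩ := tsum_double_swap hg2 hp hx
  have hterm : ∀ l : ℕ, seriesTerm c p g l = rGamma (g + 1 - c) *
      (Gamma g * (binomCoeff p l * (1 - c + l)⁻¹) - rGamma (1 - g) *
        ∑' j : ℕ, poch g j / j ! * (g + j)⁻¹ * (g + 1 - c + l + j)⁻¹ * binomCoeff p l) := by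
    intro l
    have h1 := gamma_quotient_eq_tsum hg hg2 (add_nat_ne_zero hc1 l) (fun n => by
      rw [show g + (1 - c + l) = g + 1 - c + l by ring]
      exact add_nat_ne_neg_nat hx l n)
    have h2 : poch (g + 1 - c) l = rGamma (g + 1 - c) * Gamma (g + 1 - c + l) := by
      have := Gamma_mul_rGamma hx
      rw [Gamma_add_nat hx]
      linear_combination -(poch (g + 1 - c) l) * this
    rw [show g + (1 - c + l) = g + 1 - c + l by ring,
      show 1 + (1 - c + (l : ℂ)) = 2 - c + l by ring] at h1
    rw [seriesTerm, h2, tsum_mul_right]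
    linear_combination (rGamma (g + 1 - c) * binomCoeff p l) * h1
  simp_rw [hterm]
  rw [tsum_mul_left, Summable.tsum_sub (hβ.mul_left _) (hs.mul_left _), tsum_mul_left,
    tsum_mul_left, hsum, tsum_binomCoeff_div (by linarith) hc1,
    show p + 1 - c = p + (1 - c) by ring]
  ring

/-! ### The limit of the series as `p → ∞` -/

lemma tendsto_Gamma_ratio_zero {a b : ℂ} (h : a.re < b.re) :
    Tendsto (fun N : ℕ => Gamma (a + N) * rGamma (b + N)) atTop (𝓝 0) :=
  tendsto_zero_of_isBigO_rpow (isBigO_Gamma_mul_rGamma a b rfl) (by simpa using h)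

lemma tendsto_inv_add_nat (z : ℂ) : Tendsto (fun N : ℕ => (z + N)⁻¹) atTop (𝓝 0) :=
  tendsto_zero_of_isBigO_rpow (isBigO_inv_add z) (by norm_num)

/-- Gauss's theorem turns the expression into `Γ(y-x+p-1+N) / (Γ(p+N) Γ(y-x))`. -/
lemma tendsto_gauss_zero {x y : ℂ} (p : ℂ) (h : (y - x).re < 1) :
    Tendsto (fun N : ℕ => Gamma (y + p - 1 + N) * ∑' l, gaussTerm x y (p + N) l) atTop (𝓝 0) := by
  have h0 := (tendsto_Gamma_ratio_zero (a := y - x + p - 1) (b := p)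
    (by simp at h ⊢; linarith)).mul_const (rGamma (y - x))
  rw [zero_mul] at h0
  refine h0.congr' ?_
  filter_upwards [eventually_re_add_nat_pos (y - x + p - 1), eventually_re_add_nat_pos (y + p - 1)]
    with N h1 h2
  have hG := gauss_sum (x := x) (y := y) (p := p + N)
    (Or.inr (by rwa [show y - x + (p + N) - 1 = y - x + p - 1 + N by ring]))
  have e1 := Gamma_mul_rGamma (ne_neg_nat_of_re_pos h1)
  have e2 := Gamma_mul_rGamma (ne_neg_nat_of_re_pos h2)
  rw [show y - x + (p + N) - 1 = y - x + p - 1 + N by ring,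
    show y + (p + N) - 1 = y + p - 1 + N by ring] at hG
  generalize (∑' l, gaussTerm x y (p + N) l) = G at *
  linear_combination (-Gamma (y - x + p - 1 + N) * Gamma (y + p - 1 + N)) * hG
    - (Gamma (y - x + p - 1 + N) * rGamma (p + N) * rGamma (y - x)) * e2
    + (Gamma (y + p - 1 + N) * G) * e1

/-- The normalized series `Γ(p + 1 - c) ∑ seriesTerm c p g` converges along `p + ℕ`, to the value
coming from the first partial fraction coefficient. -/
def SeriesLimit (c g : ℂ) : Prop :=
  ∀ p : ℂ, Tendsto (fun N : ℕ => Gamma (p + N + 1 - c) * ∑' l, seriesTerm c (p + N) g l) atTop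
    (𝓝 (Gamma (1 - c) * Gamma g * rGamma (g + 1 - c)))

lemma seriesLimit_of_strip {c g : ℂ} (hc : ∀ n : ℤ, c ≠ n) (hg : ∀ n : ℤ, g ≠ n)
    (hx : ∀ n : ℕ, g + 1 - c ≠ -n) (hg0 : 0 < g.re) (hg2 : g.re < 2) : SeriesLimit c g := by
  intro p
  obtain ⟨M, hM⟩ := (eventually_re_add_nat_pos (p - 1)).exists
  rw [← tendsto_add_atTop_iff_nat M]
  set P : ℂ := p + M with hP
  have hP1 : 1 < P.re := by simp [hP] at hM ⊢; linarith
  have hs : Summable fun j : ℕ => poch g j / j ! * (g + j)⁻¹ * Gamma (g + 1 - c + j)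
      * rGamma (P + (g + 1 - c) + j) := by
    have := isBigO_mul_rpow (isBigO_mul_rpow (isBigO_poch g rfl) (isBigO_inv_add g) rfl)
      (isBigO_Gamma_mul_rGamma (g + 1 - c) (P + (g + 1 - c)) rfl) rfl
    refine (summable_of_isBigO_rpow this (by simp; linarith)).congr fun j => ?_
    ring
  -- The poles at `-g - j` contribute nothing in the limit because `Re g > 0`; only the pole at `0`
  -- remains.
  have h1 := (tendsto_Gamma_ratio_zero (a := P + 1 - c) (b := P + (g + 1 - c))
    (by simp; linarith)).mul (tendsto_Gamma_mul_tsum hs)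
  rw [zero_mul] at h1
  have h2 := ((h1.const_mul (rGamma (1 - g))).const_sub (Gamma g * Gamma (1 - c))).const_mul
    (rGamma (g + 1 - c))
  rw [mul_zero, sub_zero, show rGamma (g + 1 - c) * (Gamma g * Gamma (1 - c))
    = Gamma (1 - c) * Gamma g * rGamma (g + 1 - c) by ring] at h2
  refine h2.congr' ?_
  filter_upwards [eventually_re_add_nat_pos (P + 1 - c),
    eventually_re_add_nat_pos (P + (g + 1 - c))] with N hN1 hN2
  have e1 := Gamma_mul_rGamma (ne_neg_nat_of_re_pos hN1)
  have e2 := Gamma_mul_rGamma (ne_neg_nat_of_re_pos hN2)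
  have hpN : p + ((N + M : ℕ) : ℂ) = P + N := by rw [hP]; push_cast; ring
  rw [hpN, series_eq_of_strip hc hg hx hg2
    (by simp; linarith [(Nat.cast_nonneg N : (0 : ℝ) ≤ N)]), show P + N + 1 - c = P + 1 - c + N by ring,
    show P + N + (g + 1 - c) = P + (g + 1 - c) + N by ring]
  generalize (∑' j : ℕ, poch g j / j ! * (g + j)⁻¹ * Gamma (g + 1 - c + j)
      * rGamma (P + (g + 1 - c) + N + j)) = S
  linear_combination (-rGamma (g + 1 - c) * Gamma g * Gamma (1 - c)) * e1
    - (rGamma (g + 1 - c) * rGamma (1 - g) * Gamma (P + 1 - c + N) * S) * e2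

lemma SeriesLimit.g_add_one {c g : ℂ} (h : SeriesLimit c g) (hc : ∀ n : ℤ, c ≠ n)
    (hg0 : 0 < g.re) (hx : g + 1 - c ≠ 0) : SeriesLimit c (g + 1) := by
  intro p
  have h1 := (((h p).const_mul g).add (tendsto_gauss_zero (x := g + 1 - c) (y := 2 - c) p
    (by simp; linarith))).const_mul (g + 1 - c)⁻¹
  have hg : g ≠ 0 := by rintro rfl; simp at hg0
  have e : (g + 1 - c)⁻¹ * (g * (Gamma (1 - c) * Gamma g * rGamma (g + 1 - c)) + 0)
      = Gamma (1 - c) * Gamma (g + 1) * rGamma (g + 1 + 1 - c) := by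
    rw [Gamma_add_one g hg, rGamma_eq_mul (g + 1 - c), show g + 1 - c + 1 = g + 1 + 1 - c by ring]
    field_simp
    ring
  rw [e] at h1
  refine h1.congr' ?_
  filter_upwards [eventually_re_add_nat_pos (p - g)] with N hN
  have h2 := series_g_add_one (c := c) (p := p + N) (g := g) hc
    (Or.inr (by rwa [show p + N - g = p - g + N by ring]))
  rw [show 2 - c + p - 1 + N = p + N + 1 - c by ring, inv_mul_eq_iff_eq_mul₀ hx]
  linear_combination (-Gamma (p + N + 1 - c)) * h2

lemma SeriesLimit.c_add_one {c g : ℂ} (h : SeriesLimit c g) (hc : ∀ n : ℤ, c ≠ n)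
    (hg0 : 0 < g.re) : SeriesLimit (c + 1) g := by
  intro p
  have hG := tendsto_gauss_zero (x := g + 1 - c) (y := 2 - c) p (by simp; linarith)
  have hG' := tendsto_gauss_zero (x := g - c) (y := 1 - c) p (by simp; linarith)
  have h1 := ((((tendsto_inv_add_nat (p - c)).mul hG).sub (h p)).const_mul (g - c)).sub hG'
  have h2 := h1.const_mul c⁻¹
  have hc0 : c ≠ 0 := by simpa using hc 0
  have e : c⁻¹ * ((g - c) * (0 * 0 - Gamma (1 - c) * Gamma g * rGamma (g + 1 - c)) - 0)
      = Gamma (1 - (c + 1)) * Gamma g * rGamma (g + 1 - (c + 1)) := by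
    rw [show 1 - c = -c + 1 by ring, Gamma_add_one (-c) (neg_ne_zero.2 hc0),
      show g + 1 - (c + 1) = g - c by ring, rGamma_eq_mul (g - c),
      show 1 - (c + 1) = -c by ring, show g - c + 1 = g + 1 - c by ring]
    field_simp
    ring
  rw [e] at h2
  refine h2.congr' ?_
  filter_upwards [eventually_re_add_nat_pos (p - g), eventually_re_add_nat_pos (p - c)] with N hN hN'
  have h3 := series_c_add_one (c := c) (p := p + N) (g := g) hc
    (Or.inr (by rwa [show p + N - g = p - g + N by ring]))
  have hne : p - c + N ≠ 0 := by
    intro h0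
    rw [h0] at hN'
    simp at hN'
  have e1 : Gamma (p + N + 1 - c) = (p - c + N) * Gamma (p - c + N) := by
    rw [← Gamma_add_one _ hne]; ring_nf
  rw [show 2 - c + p - 1 + N = p + N + 1 - c by ring, show 1 - c + p - 1 + N = p - c + N by ring,
    show p + N + 1 - (c + 1) = p - c + N by ring, inv_mul_eq_iff_eq_mul₀ hc0, e1]
  rw [← mul_assoc _ (_ * _), inv_mul_cancel_left₀ hne]
  linear_combination (-Gamma (p - c + N)) * h3

theorem seriesLimit {c g : ℂ} (hc : ∀ n : ℤ, c ≠ n) (hg : ∀ n : ℤ, g ≠ n)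
    (hx : ∀ n : ℕ, g + 1 - c ≠ -n) (hg0 : 0 < g.re) : SeriesLimit c g := by
  obtain ⟨k, hk⟩ := exists_nat_gt (g.re - 1)
  induction k generalizing c g with
  | zero => exact seriesLimit_of_strip hc hg hx hg0 (by simp at hk; linarith)
  | succ k ih =>
    by_cases h1 : g.re ≤ 1
    · exact seriesLimit_of_strip hc hg hx hg0 (by linarith)
    have hc' : ∀ n : ℤ, c - 1 ≠ n := by
      simpa [sub_eq_add_neg] using add_int_ne_int hc (-1)
    have hg' : ∀ n : ℤ, g - 1 ≠ n := by
      simpa [sub_eq_add_neg] using add_int_ne_int hg (-1)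
    -- Lowering `c` and `g` together fixes `g + 1 - c`, so the nonvanishing hypothesis survives the
    -- induction.
    have e : g - 1 + 1 - (c - 1) = g + 1 - c := by ring
    have h2 := ih hc' hg' (by rwa [e]) (by simp; linarith) (by push_cast at hk; simp; linarith)
    have h3 := h2.g_add_one hc' (by simp; linarith) (by rw [e]; simpa using hx 0)
    rw [sub_add_cancel] at h3
    simpa using h3.c_add_one hc' hg0

/-! ### The series `∑ (c)_l / (Γ(p + l) (g + l))` -/

/-- The general term `(c)_l / (Γ(p + l) (g + l))`. -/
noncomputable def leftTerm (c p g : ℂ) (l : ℕ) : ℂ := poch c l * rGamma (p + l) * (g + l)⁻¹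

/-- The closed form of `∑ leftTerm c p g` in terms of `∑ seriesTerm c p g`. -/
noncomputable def closedForm (c p g : ℂ) : ℂ :=
  rGamma p / (p - c) - rGamma (p - g) * (Gamma (1 + g) * Gamma (-g) * Gamma (1 - c) *
    rGamma (g + 1 - c) + Gamma (1 - g) * Gamma (p + 1 - c) * ∑' l, seriesTerm c p g l)

lemma ne_zero_of_re_pos {z : ℂ} (hz : 0 < z.re) : z ≠ 0 := by
  rintro rfl
  simp at hz

lemma tendsto_poch_mul_rGamma_zero {c p : ℂ} (hpc : 0 < (p - c).re) :
    Tendsto (fun l : ℕ => poch c l * rGamma (p + l)) atTop (𝓝 0) :=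
  tendsto_zero_of_isBigO_rpow (isBigO_poch_mul_rGamma c p rfl) (by simp at hpc ⊢; linarith)

lemma summable_leftTerm {c p g : ℂ} (hpc : 0 < (p - c).re) : Summable (leftTerm c p g) :=
  summable_of_isBigO_rpow (isBigO_mul_rpow (isBigO_poch_mul_rGamma c p rfl)
    (isBigO_inv_add g) rfl) (by simp at hpc ⊢; linarith)

lemma summable_poch_mul_rGamma {c p : ℂ} (hpc : 0 < (p - c).re) :
    Summable fun l : ℕ => poch c l * rGamma (p + 1 + l) :=
  summable_of_isBigO_rpow (isBigO_poch_mul_rGamma c (p + 1) rfl) (by simp at hpc ⊢; linarith)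

lemma poch_mul_rGamma_sub (c p : ℂ) (l : ℕ) :
    poch c l * rGamma (p + l) - poch c (l + 1) * rGamma (p + (l + 1 : ℕ))
      = (p - c) * (poch c l * rGamma (p + 1 + l)) := by
  rw [poch_succ, rGamma_eq_mul (p + l)]
  push_cast
  rw [show p + (l + 1 : ℂ) = p + l + 1 by ring, show p + 1 + l = p + l + 1 by ring]
  ring

lemma tsum_poch_mul_rGamma {c p : ℂ} (hpc : 0 < (p - c).re) :
    ∑' l : ℕ, poch c l * rGamma (p + 1 + l) = rGamma p / (p - c) := by
  have h := tsum_eq_of_telescope ((summable_poch_mul_rGamma hpc).mul_left (p - c))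
    (X := fun l : ℕ => -(poch c l * rGamma (p + l)))
    (fun l => by rw [← poch_mul_rGamma_sub]; ring) (tendsto_poch_mul_rGamma_zero hpc).neg
  rw [tsum_mul_left] at h
  rw [eq_div_iff (ne_zero_of_re_pos hpc), mul_comm, h]
  simp

lemma tsum_leftTerm_add_one {c p g : ℂ} (hg : ∀ n : ℤ, g ≠ n) (hpc : 0 < (p - c).re) :
    ∑' l, leftTerm c p g l = rGamma p / (p - c) + (p - g) * ∑' l, leftTerm c (p + 1) g l := by
  rw [← tsum_poch_mul_rGamma hpc, ← tsum_mul_left, ← Summable.tsum_add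
    (summable_poch_mul_rGamma hpc) ((summable_leftTerm (by simp at hpc ⊢; linarith)).mul_left _)]
  refine tsum_congr fun l => ?_
  have h0 := add_nat_ne_zero (ne_neg_nat_of_ne_int hg) l
  rw [leftTerm, leftTerm, rGamma_eq_mul (p + l), show p + 1 + l = p + l + 1 by ring]
  field_simp
  ring

/-- Term `l + 1` for `g` and term `l` for `g + 1` share the denominator `g + l + 1`; the combination
cancels it and telescopes. -/
lemma tsum_leftTerm_g_add_one {c p g : ℂ} (hg : ∀ n : ℤ, g ≠ n) (hpc : 0 < (p - c).re) :
    (p - g - 1) * ∑' l, leftTerm c p g l + (g + 1 - c) * ∑' l, leftTerm c p (g + 1) l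
      = rGamma (p - 1) / g := by
  have hs := summable_leftTerm (g := g) hpc
  have hs' := summable_leftTerm (g := g + 1) hpc
  have hs1 : Summable fun l => leftTerm c p g (l + 1) := (summable_nat_add_iff 1).2 hs
  have h := tsum_eq_of_telescope ((hs1.mul_left (p - g - 1)).add (hs'.mul_left (g + 1 - c)))
    (X := fun l : ℕ => -(poch c l * rGamma (p + l))) (fun l => ?_)
    (tendsto_poch_mul_rGamma_zero hpc).neg
  · rw [Summable.tsum_add (hs1.mul_left _) (hs'.mul_left _), tsum_mul_left, tsum_mul_left] at h
    have hg0 : g ≠ 0 := by simpa using hg 0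
    have h1 := rGamma_eq_mul (p - 1)
    rw [sub_add_cancel] at h1
    rw [hs.tsum_eq_zero_add, h1]
    simp only [poch_zero, Nat.cast_zero, add_zero, neg_zero, one_mul] at h
    have h2 : leftTerm c p g 0 = rGamma p / g := by simp [leftTerm, div_eq_mul_inv]
    rw [h2]
    field_simp
    linear_combination g * h
  · have h0 := add_nat_ne_zero (ne_neg_nat_of_ne_int hg) (l + 1)
    rw [leftTerm, leftTerm]
    push_cast at h0 ⊢
    have h0' : g + 1 + l ≠ 0 := by rwa [show g + 1 + l = g + (l + 1 : ℂ) by ring]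
    rw [poch_succ, rGamma_eq_mul (p + l), show p + (l + 1 : ℂ) = p + l + 1 by ring,
      show g + (l + 1 : ℂ) = g + 1 + l by ring]
    field_simp
    ring

/-- `series_add_one_right`, with its Gauss series evaluated, supplies the inhomogeneous term. -/
lemma closedForm_add_one {c p g : ℂ} (hc : ∀ n : ℤ, c ≠ n) (hg : ∀ n : ℤ, g ≠ n)
    (hpc : 0 < (p - c).re) (h : (∃ n : ℤ, p = n) ∨ -1 < (p - g).re) :
    closedForm c p g = rGamma p / (p - c) + (p - g) * closedForm c (p + 1) g := by
  have hT := series_add_one_right hc h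
  have hG := gauss_sum (x := g + 1 - c) (y := 2 - c) (p := p + 1)
    (h.imp (fun ⟨n, hn⟩ => ⟨n + 1, by rw [hn]; push_cast; rfl⟩) fun h => by
      rw [show 2 - c - (g + 1 - c) + (p + 1) - 1 = p - g + 1 by ring]
      rw [add_re, one_re]; linarith)
  rw [show 2 - c - (g + 1 - c) + (p + 1) - 1 = p - g + 1 by ring,
    show 2 - c - (g + 1 - c) = 1 - g by ring, show 2 - c + (p + 1) - 1 = p + 1 - c + 1 by ring,
    ← hT] at hG
  have hpos : 0 < (p + 1 - c).re := by simp at hpc ⊢; linarith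
  have hne := ne_zero_of_re_pos hpos
  have e1 := Gamma_mul_rGamma (ne_neg_nat_of_ne_int (by simpa using int_sub_ne_int hg 1))
  have e2 := Gamma_mul_rGamma (ne_neg_nat_of_re_pos hpos)
  rw [rGamma_eq_mul (p + 1 - c)] at e2
  rw [closedForm, closedForm, rGamma_eq_mul (p - g), show p + 1 - g = p - g + 1 by ring,
    show p + 1 + 1 - c = p + 1 - c + 1 by ring, Gamma_add_one _ hne]
  generalize (∑' l, seriesTerm c p g l) = A at *
  generalize (∑' l, seriesTerm c (p + 1) g l) = B at *
  have e3 : Gamma (1 - g) * Gamma (p + 1 - c) * rGamma (p - g + 1) * ((p + 1 - c) * B - A)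
      = rGamma (p + 1) / (p + 1 - c) := by
    rw [eq_div_iff hne]
    linear_combination (Gamma (1 - g) * Gamma (p + 1 - c) * (p + 1 - c)) * hG
      + (Gamma (1 - g) * rGamma (1 - g) * rGamma (p + 1)) * e2 + rGamma (p + 1) * e1
  linear_combination (p - g) * e3

lemma closedForm_g_add_one {c p g : ℂ} (hc : ∀ n : ℤ, c ≠ n) (hg : ∀ n : ℤ, g ≠ n)
    (hpc : 0 < (p - c).re) (h : (∃ n : ℤ, p = n) ∨ 0 < (p - g).re) :
    (p - g - 1) * closedForm c p g + (g + 1 - c) * closedForm c p (g + 1)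
      = rGamma (p - 1) / g := by
  have hT := series_g_add_one hc h
  have hG := gauss_sum (x := g + 1 - c) (y := 2 - c) (p := p)
    (h.imp_right fun h => by rwa [show 2 - c - (g + 1 - c) + p - 1 = p - g by ring])
  rw [show 2 - c - (g + 1 - c) + p - 1 = p - g by ring,
    show 2 - c - (g + 1 - c) = 1 - g by ring, show 2 - c + p - 1 = p + 1 - c by ring] at hG
  have hpos : 0 < (p + 1 - c).re := by simp at hpc ⊢; linarith
  have hne := ne_zero_of_re_pos hpc
  have hg0 : g ≠ 0 := by simpa using hg 0
  have hg1 : 1 + g ≠ 0 := by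
    intro h0
    apply hg (-1)
    push_cast
    linear_combination h0
  have hg1' : -g - 1 ≠ 0 := by
    rw [show -g - 1 = -(1 + g) by ring]
    exact neg_ne_zero.2 hg1
  have e1 := Gamma_mul_rGamma (ne_neg_nat_of_ne_int (by simpa using int_sub_ne_int hg 1))
  have e2 := Gamma_mul_rGamma (ne_neg_nat_of_re_pos hpos)
  have e3 := rGamma_eq_mul (p - 1)
  have e4 := rGamma_eq_mul (p - g - 1)
  have e5 := rGamma_eq_mul (g + 1 - c)
  have e6 := Gamma_add_one (1 + g) hg1
  have e7 := Gamma_add_one (-g - 1) hg1'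
  have e8 := Gamma_add_one (-g) (neg_ne_zero.2 hg0)
  rw [sub_add_cancel] at e3 e4 e7
  rw [closedForm, closedForm, show p - (g + 1) = p - g - 1 by ring, e4, e3,
    show 1 + (g + 1) = 1 + g + 1 by ring, e6, show -(g + 1) = -g - 1 by ring,
    show g + 1 + 1 - c = g + 1 - c + 1 by ring, show 1 - (g + 1) = -g by ring, e5, e7,
    show 1 - g = -g + 1 by ring, e8]
  rw [show 1 - g = -g + 1 by ring, e8] at e1
  rw [show 1 - g = -g + 1 by ring] at hG
  generalize (∑' l, seriesTerm c p g l) = A at *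
  generalize (∑' l, seriesTerm c p (g + 1) l) = B at *
  generalize (∑' l, gaussTerm (g + 1 - c) (2 - c) p l) = G at *
  have e9 : rGamma (p - g) * (Gamma (-g) * Gamma (p + 1 - c) * (g * A - (g + 1 - c) * B))
      = rGamma p / g := by
    rw [eq_div_iff hg0]
    linear_combination (-g * rGamma (p - g) * Gamma (-g) * Gamma (p + 1 - c)) * hT
      - (g * Gamma (-g) * Gamma (p + 1 - c)) * hG
      - (g * Gamma (-g) * rGamma (-g + 1) * rGamma p) * e2 + rGamma p * e1
  have e10 : rGamma p / (p - c) * (p - c) = rGamma p := div_mul_cancel₀ _ hne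
  have e11 : (p - 1) * rGamma p / g = rGamma p + (p - g - 1) * (rGamma p / g) := by
    field_simp
    ring
  rw [e11]
  linear_combination (p - g - 1) * e9 + e10
    + (p - g - 1) * (g + 1 - c) * rGamma (p - g) * Gamma (p + 1 - c) * B * e7

/-! ### Evaluation of the series -/

lemma leftTerm_sub_closedForm_iterate {c p g : ℂ} (hc : ∀ n : ℤ, c ≠ n) (hg : ∀ n : ℤ, g ≠ n)
    (hpc : 0 < (p - c).re) (h : (∃ n : ℤ, p = n) ∨ -1 < (p - g).re) (N : ℕ) :
    ∑' l, leftTerm c p g l - closedForm c p g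
      = poch (p - g) N * (∑' l, leftTerm c (p + N) g l - closedForm c (p + N) g) := by
  induction N generalizing p with
  | zero => simp
  | succ N ih =>
    have h1 := ih (p := p + 1) (by simp at hpc ⊢; linarith)
      (h.imp (fun ⟨n, hn⟩ => ⟨n + 1, by rw [hn]; push_cast; rfl⟩) fun h => by
        simp at h ⊢; linarith)
    rw [tsum_leftTerm_add_one hg hpc, closedForm_add_one hc hg hpc h, poch_succ']
    push_cast
    rw [show p - g + 1 = p + 1 - g by ring, show p + (N + 1 : ℂ) = p + 1 + N by ring]
    linear_combination (p - g) * h1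

lemma leftTerm_eq_of_re_pos {c p g : ℂ} (hc : ∀ n : ℤ, c ≠ n) (hg : ∀ n : ℤ, g ≠ n)
    (hx : ∀ n : ℕ, g + 1 - c ≠ -n) (hpc : 0 < (p - c).re)
    (h : (∃ n : ℤ, p = n) ∨ -1 < (p - g).re) (hg0 : 0 < g.re) :
    ∑' l, leftTerm c p g l = closedForm c p g := by
  have hr : Tendsto (fun N : ℕ => poch (p - g) N * rGamma (p + N)) atTop (𝓝 0) :=
    tendsto_poch_mul_rGamma_zero (by simpa using hg0)
  have hq : Summable fun l : ℕ => (poch c l * (g + l)⁻¹) * rGamma (p + l) :=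
    (summable_leftTerm (g := g) hpc).congr fun l => by rw [leftTerm]; ring
  have h1 := (hr.mul (tendsto_Gamma_mul_tsum hq)).sub (hr.mul (tendsto_inv_add_nat (p - c)))
  have h2 := (((seriesLimit hc hg hx hg0 p).const_mul (Gamma (1 - g))).const_add
    (Gamma (1 + g) * Gamma (-g) * Gamma (1 - c) * rGamma (g + 1 - c))).const_mul (rGamma (p - g))
  have h3 := h1.add h2
  have hg' : g ≠ 0 := by simpa using hg 0
  -- The two limits cancel because `Γ(1+g)Γ(-g) = -Γ(1-g)Γ(g)`.
  have e : 0 * (poch c 0 * (g + (0 : ℕ))⁻¹) - 0 * 0 + rGamma (p - g) * (Gamma (1 + g) * Gamma (-g) *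
      Gamma (1 - c) * rGamma (g + 1 - c) + Gamma (1 - g) * (Gamma (1 - c) * Gamma g *
      rGamma (g + 1 - c))) = 0 := by
    rw [add_comm 1 g, Gamma_add_one g hg', show 1 - g = -g + 1 by ring,
      Gamma_add_one (-g) (neg_ne_zero.2 hg')]
    ring
  rw [e] at h3
  rw [← sub_eq_zero]
  refine tendsto_nhds_unique (tendsto_const_nhds.congr' ?_) h3
  filter_upwards [eventually_re_add_nat_pos p] with N hN
  rw [leftTerm_sub_closedForm_iterate hc hg hpc h N, closedForm, rGamma_eq_poch_mul (p - g) N,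
    show p + N - g = p - g + N by ring]
  have e1 := Gamma_mul_rGamma (ne_neg_nat_of_re_pos hN)
  have e2 : ∑' l, leftTerm c (p + N) g l
      = ∑' l : ℕ, poch c l * (g + l)⁻¹ * rGamma (p + N + l) :=
    tsum_congr fun l => by rw [leftTerm]; ring
  rw [e2, show p - c + N = p + N - c by ring, div_eq_mul_inv]
  generalize (∑' l : ℕ, poch c l * (g + l)⁻¹ * rGamma (p + N + l)) = S
  linear_combination (-poch (p - g) N * S) * e1

lemma leftTerm_eq_of_ne {c p g : ℂ} (hc : ∀ n : ℤ, c ≠ n) (hg : ∀ n : ℤ, g ≠ n)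
    (hx : ∀ n : ℕ, g + 1 - c ≠ -n) (hpc : 0 < (p - c).re)
    (h : (∃ n : ℤ, p = n) ∨ -1 < (p - g).re) :
    ∑' l, leftTerm c p g l = closedForm c p g := by
  obtain ⟨k, hk⟩ := exists_nat_gt (-g.re)
  induction k generalizing p g with
  | zero => exact leftTerm_eq_of_re_pos hc hg hx hpc h (by simpa using hk)
  | succ k ih =>
    -- Raising `p` first makes the coefficient `p + N - g - 1` nonzero, so the `g`-recurrence
    -- determines the value at `g` from that at `g + 1`.
    obtain ⟨N, hN⟩ := (eventually_re_add_nat_pos (p - g - 1)).exists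
    have hN' : 0 < (p + N - (g + 1)).re := by
      rwa [show p + N - (g + 1) = p - g - 1 + N by ring]
    have hpN : 0 < (p + N - c).re := by
      have : (0 : ℝ) ≤ N := Nat.cast_nonneg N
      simp at hpc ⊢; linarith
    have h1 := ih (g := g + 1) (p := p + N) (by simpa using add_int_ne_int hg 1)
      (fun n => by
        have := add_nat_ne_neg_nat hx 1 n
        rwa [show g + 1 + 1 - c = g + 1 - c + (1 : ℕ) by push_cast; ring])
      hpN (Or.inr (by linarith)) (by push_cast at hk; simp; linarith)
    have h2 := tsum_leftTerm_g_add_one hg hpN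
    rw [← closedForm_g_add_one hc hg hpN
      (Or.inr (by simp at hN' ⊢; linarith)), h1, add_left_inj] at h2
    have h3 : p + N - g - 1 ≠ 0 := by
      rw [show p + N - g - 1 = p + N - (g + 1) by ring]
      exact ne_zero_of_re_pos hN'
    rw [← sub_eq_zero, leftTerm_sub_closedForm_iterate hc hg hpc h N, mul_left_cancel₀ h3 h2,
      sub_self, mul_zero]

/-- At `k = 0` the coefficient `g + 1 - c` vanishes, so the `g`-recurrence alone fixes the value;
larger `k` follow by descending in `g`. -/
lemma leftTerm_eq_of_eq_add_nat {c p g : ℂ} (hc : ∀ n : ℤ, c ≠ n) (hg : ∀ n : ℤ, g ≠ n)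
    (hpc : 0 < (p - c).re) {k : ℕ} (hk : c = g + 1 + k) :
    ∑' l, leftTerm c p g l = closedForm c p g := by
  induction k generalizing g with
  | zero =>
    have hgc : g + 1 - c = 0 := by rw [hk]; simp
    have h2 := tsum_leftTerm_g_add_one hg hpc
    rw [← closedForm_g_add_one hc hg hpc (Or.inr (by rw [hk] at hpc; simp at hpc ⊢; linarith)),
      hgc, zero_mul, zero_mul, add_left_inj] at h2
    refine mul_left_cancel₀ ?_ h2
    rw [show p - g - 1 = p - c by linear_combination -hgc]
    exact ne_zero_of_re_pos hpc
  | succ k ih =>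
    have h1 := ih (g := g + 1) (by simpa using add_int_ne_int hg 1) (by rw [hk]; push_cast; ring)
    have hkr : c.re = g.re + 1 + (k + 1) := by rw [hk]; simp
    have hk0 : (0 : ℝ) ≤ k := Nat.cast_nonneg k
    have h2 := tsum_leftTerm_g_add_one hg hpc
    rw [← closedForm_g_add_one hc hg hpc (Or.inr (by simp at hpc ⊢; linarith)),
      h1, add_left_inj] at h2
    refine mul_left_cancel₀ (ne_zero_of_re_pos ?_) h2
    simp at hpc ⊢
    linarith

theorem tsum_leftTerm {c p g : ℂ} (hc : ∀ n : ℤ, c ≠ n) (hg : ∀ n : ℤ, g ≠ n)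
    (hpc : 0 < (p - c).re) (h : (∃ n : ℤ, p = n) ∨ -1 < (p - g).re) :
    ∑' l, leftTerm c p g l = closedForm c p g := by
  by_cases hx : ∀ n : ℕ, g + 1 - c ≠ -n
  · exact leftTerm_eq_of_ne hc hg hx hpc h
  · push Not at hx
    obtain ⟨n, hn⟩ := hx
    exact leftTerm_eq_of_eq_add_nat hc hg hpc (k := n) (by linear_combination -hn)

/-! ### Summation by parts against the digamma function -/

lemma digamma_add_nat {f : ℂ} (hf : ∀ n : ℕ, f ≠ -n) (n : ℕ) :
    digamma (f + n) = digamma f + ∑ j ∈ Finset.range n, (f + j)⁻¹ := by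
  induction n with
  | zero => simp
  | succ n ih =>
    rw [Finset.sum_range_succ, ← add_assoc, ← ih,
      ← digamma_apply_add_one _ (add_nat_ne_neg_nat hf n)]
    push_cast
    rw [add_assoc]

/-- The growth is logarithmic, by comparison with harmonic sums. -/
lemma isBigO_digamma {f : ℂ} (hf : ∀ n : ℕ, f ≠ -n) {ε : ℝ} (hε : 0 < ε) :
    (fun n : ℕ => digamma (f + n)) =O[atTop] fun n : ℕ => (n : ℝ) ^ ε := by
  obtain ⟨C, hC, hb⟩ := exists_norm_inv_add_le f
  refine IsBigO.of_bound (‖digamma f‖ + C * (1 + 1 / ε)) ?_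
  filter_upwards [eventually_ge_atTop 1] with n hn
  have hn1 : (1 : ℝ) ≤ n := by exact_mod_cast hn
  have h1 : ‖∑ j ∈ Finset.range n, (f + j)⁻¹‖ ≤ C * (1 + Real.log n) := by
    refine (norm_sum_le _ _).trans ((Finset.sum_le_sum fun j _ => hb j).trans ?_)
    rw [← Finset.mul_sum]
    have := harmonic_le_one_add_log n
    simp only [harmonic, Rat.cast_sum, Rat.cast_inv, Nat.cast_add,
      Nat.cast_one] at this
    push_cast at this
    gcongr
  have h2 := Real.log_le_rpow_div (Nat.cast_nonneg (α := ℝ) n) hε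
  have h3 := Real.one_le_rpow hn1 hε.le
  rw [Real.norm_of_nonneg (by positivity), digamma_add_nat hf]
  calc ‖digamma f + ∑ j ∈ Finset.range n, (f + j)⁻¹‖
      ≤ ‖digamma f‖ * (n : ℝ) ^ ε + C * ((n : ℝ) ^ ε + (n : ℝ) ^ ε / ε) := by
        refine (norm_add_le _ _).trans (add_le_add (le_mul_of_one_le_right (norm_nonneg _) h3)
          (h1.trans ?_))
        gcongr
    _ = _ := by ring

theorem hasSum_digamma {c p g : ℂ} (hc : ∀ n : ℤ, c ≠ n) (hg : ∀ n : ℤ, g ≠ n)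
    (hpc : 0 < (p - c).re) (h : (∃ n : ℤ, p = n) ∨ -1 < (p - g).re) :
    HasSum (fun l : ℕ => Gamma (c + l) / Gamma (p + 1 + l) * digamma (g + 1 + l))
      (Gamma c / (p - c) * (digamma g * rGamma p + closedForm c p g)) := by
  have hg' := ne_neg_nat_of_ne_int hg
  have hg1 : ∀ n : ℕ, g + 1 ≠ -n := ne_neg_nat_of_ne_int (by simpa using add_int_ne_int hg 1)
  have hε : 0 < (p - c).re / 2 := by linarith
  have hs : Summable fun l : ℕ => poch c l * rGamma (p + 1 + l) * digamma (g + 1 + l) :=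
    summable_of_isBigO_rpow (isBigO_mul_rpow (isBigO_poch_mul_rGamma c (p + 1) rfl)
      (isBigO_digamma hg1 hε) rfl) (by simp at hpc ⊢; linarith)
  have hv : Tendsto (fun l : ℕ => -(poch c l * rGamma (p + l) * digamma (g + l))) atTop (𝓝 0) := by
    have := (tendsto_zero_of_isBigO_rpow (isBigO_mul_rpow (isBigO_poch_mul_rGamma c p rfl)
      (isBigO_digamma hg' hε) rfl) (by simp at hpc ⊢; linarith)).neg
    simpa using this
  have hl := summable_leftTerm (g := g) hpc
  have ht := tsum_eq_of_telescope ((hs.mul_left (p - c)).sub hl) (fun l => by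
    have h1 := poch_mul_rGamma_sub c p l
    have h2 := digamma_apply_add_one _ (add_nat_ne_neg_nat hg' l)
    rw [leftTerm]
    rw [show g + 1 + l = g + l + 1 by ring, show g + ((l + 1 : ℕ) : ℂ) = g + l + 1 by
      push_cast; ring, h2]
    linear_combination (-(digamma (g + l) + (g + l)⁻¹)) * h1) hv
  rw [Summable.tsum_sub (hs.mul_left _) hl, tsum_mul_left, tsum_leftTerm hc hg hpc h] at ht
  simp only [poch_zero, Nat.cast_zero, add_zero, one_mul] at ht
  have hne := ne_zero_of_re_pos hpc
  have hS : ∑' l : ℕ, poch c l * rGamma (p + 1 + l) * digamma (g + 1 + l)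
      = (p - c)⁻¹ * (digamma g * rGamma p + closedForm c p g) := by
    rw [eq_inv_mul_iff_mul_eq₀ hne]
    linear_combination ht
  have := hs.hasSum.mul_left (Gamma c)
  rw [hS, ← mul_assoc, ← div_eq_mul_inv] at this
  refine this.congr_fun fun l => ?_
  rw [Gamma_add_nat (ne_neg_nat_of_ne_int hc), div_eq_mul_inv, ← rGamma]
  ring

end GammaSum

/-! ### The theorem in the original parameters -/

open GammaSum in
theorem theorem4p5 (c m f : ℂ)
    (hc : ∀ n : ℤ, c ≠ n) (hf : ∀ n : ℤ, f ≠ n)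
    (hmc : 1 < (m - c).re)
    (hmf : (∃ n : ℤ, m = n) ∨ -1 < (m - f).re) :
    ((∀ k : ℕ, c ≠ f + k) →
      (∀ n : ℤ, m = n → ∀ l : ℕ, n - 1 ≤ (l : ℤ) → auxTerm c m f l = 0) ∧
      Summable (fun l : ℕ => auxTerm c m f l) ∧
      HasSum
        (fun l : ℕ => Complex.Gamma (c + l) / Complex.Gamma (m + l) * Complex.digamma (f + l))
        (Complex.Gamma c / (m - c - 1) *
          ((Complex.digamma (f - 1) + 1 / (m - c - 1)) / Complex.Gamma (m - 1)
            - Complex.Gamma f * Complex.Gamma (1 - f) * Complex.Gamma (1 - c)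
                / (Complex.Gamma (f - c) * Complex.Gamma (m - f))
            - Complex.Gamma (2 - f) * Complex.Gamma (m - c)
                / (Complex.Gamma (m - f) * Complex.Gamma (f - c))
              * ∑' l : ℕ, auxTerm c m f l))) ∧
    (∀ k : ℕ, c = f + k →
      HasSum
        (fun l : ℕ => Complex.Gamma (c + l) / Complex.Gamma (m + l) * Complex.digamma (f + l))
        (Complex.Gamma c / (m - c - 1) *
          ((Complex.digamma (f - 1) + 1 / (m - c - 1)) / Complex.Gamma (m - 1)
            - Complex.Gamma (2 - f) * Complex.Gamma (m - c) / Complex.Gamma (m - f)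
              * ∑ l ∈ Finset.range (k + 1), auxTermRatio c m f l))) := by
  have hg : ∀ n : ℤ, f - 1 ≠ n := by
    simpa [sub_eq_add_neg] using add_int_ne_int hf (-1)
  have hpc : 0 < (m - 1 - c).re := by simp at hmc ⊢; linarith
  have hcond : (∃ n : ℤ, m - 1 = n) ∨ -1 < (m - 1 - (f - 1)).re :=
    hmf.imp (fun ⟨n, hn⟩ => ⟨n - 1, by rw [hn]; push_cast; rfl⟩) fun h => by
      rwa [show m - 1 - (f - 1) = m - f by ring]
  have hmain := hasSum_digamma hc hg hpc hcond
  have hratio : ∀ l, auxTermRatio c m f l = seriesTerm c (m - 1) (f - 1) l := fun l => by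
    rw [auxTermRatio, seriesTerm, binomCoeff, poch, rGamma, rGamma, rGamma,
      show f - 1 + 1 - c = f - c by ring, div_eq_mul_inv, mul_inv, mul_inv, mul_inv]
    ring
  rw [closedForm] at hmain
  simp_rw [← hratio] at hmain
  rw [show m - 1 - (f - 1) = m - f by ring, show f - 1 + 1 - c = f - c by ring,
    show 1 + (f - 1) = f by ring, show -(f - 1) = 1 - f by ring,
    show 1 - (f - 1) = 2 - f by ring, show m - 1 + 1 - c = m - c by ring] at hmain
  simp only [sub_add_cancel, show m - 1 - c = m - c - 1 by ring] at hmain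
  refine ⟨fun hk => ?_, fun k hk => ?_⟩
  · have hx : ∀ n : ℕ, f - c ≠ -n := fun n hn => hk n (by linear_combination -hn)
    have haux : ∀ l, auxTerm c m f l = Gamma (f - c) * auxTermRatio c m f l := fun l => by
      rw [auxTerm, auxTermRatio, Gamma_add_nat hx, poch]
      ring
    have hsum : Summable fun l => auxTermRatio c m f l := by
      simp_rw [hratio]
      exact summable_seriesTerm hcond
    refine ⟨?_, ?_, ?_⟩
    · rintro n rfl l hl
      rw [haux, hratio, seriesTerm,
        show ((n : ℂ) - 1) = ((n - 1 : ℤ) : ℂ) by push_cast; rfl,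
        binomCoeff_intCast_eq_zero _ hl, mul_zero, mul_zero]
    · simp_rw [haux]
      exact hsum.mul_left _
    · convert hmain using 1
      simp_rw [haux, tsum_mul_left, rGamma]
      have h1 := inv_mul_cancel₀ (Gamma_ne_zero hx)
      generalize (∑' l, auxTermRatio c m f l) = S
      simp only [div_eq_mul_inv, mul_inv]
      linear_combination (-Gamma c * (m - c - 1)⁻¹ * Gamma (2 - f) * Gamma (m - c) *
        (Gamma (m - f))⁻¹ * S) * h1
  · have hfin : ∑' l, auxTermRatio c m f l = ∑ l ∈ Finset.range (k + 1), auxTermRatio c m f l := by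
      refine tsum_eq_sum fun l hl => ?_
      rw [Finset.mem_range, not_lt] at hl
      rw [auxTermRatio, (ascPochhammer_eval_eq_zero_iff l (f - c)).2 ⟨k, hl, ?_⟩]
      · simp
      · rw [hk]; ring
    -- Here `1 / Γ(f-c) = 0` removes the second term of the formula.
    rw [hfin, show f - c = -k by rw [hk]; ring, rGamma_neg_nat] at hmain
    convert hmain using 1
    simp only [rGamma]
    ring
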